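/- **Setting.** Let $d,n\ge 0$ be integers and let $\mathbf y^{(1)},\dots,\mathbf y^{(n)}\in\mathbb N^d$ be observed count vectors. Put $\mathcal K=\{(i,j):1\le j<i\le d\}$ and $p=d(d-1)/2$. The unconstrained parameters are $\eta\in\mathbb R^d$ and $\zeta\in\mathbb R^{\mathcal K}$. Set $\lambda_k=e^{\eta_k}$, $\Lambda(x)=e^x/(1+e^x)$, $\omega_{ij}=\pi\Lambda(\zeta_{ij})$ for $(i,j)\in\mathcal K$, and $q_{im}=\prod_{k=1}^{m-1}\sin\omega_{ik}$ for $1\le m\le i$. Let $L=(\alpha_{ij})$ be the lower triangular $d\times d$ matrix with $\alpha_{ij}=q_{ij}\cos\omega_{ij}$ for $j<i$, $\alpha_{ii}=q_{ii}$ and $\alpha_{ij}=0$ for $j>i$. The correlation matrix is $\mathbf P=(\rho_{ij})=LL^\top$. $\Phi$ is the standard normal distribution function, with $\Phi^{-1}(0)=-\infty$. $\varphi_2(\cdot,\cdot;\rho)$ is the standard bivariate normal density with correlation $\rho$, taken to be $0$ at infinite arguments. $\Phi_m(\cdot;\mu,\Sigma)$ is the $m$-variate normal distribution function with mean $\mu$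 and covariance $\Sigma$, with $\Phi_0=1$. $f_{Y_k}$ and $F_{Y_k}$ are the Poisson($\lambda_k$) probability mass function and distribution function, which vanish at negative integers. $\varphi_{\mathbf P}$ is the centred normal density on $\mathbb R^d$ with covariance matrix $\mathbf P$. For $\mathbf y\in\mathbb N^d$ the probability mass function of the Gaussian copula model with Poisson margins is $$h(\mathbf y)=\int_{\prod_j(\Phi^{-1}(F_{Y_j}(y_j-1)),\,\Phi^{-1}(F_{Y_j}(y_j))]}\varphi_{\mathbf P}(z)\,dz ,$$ and the log-likelihood is $\ell(\eta,\zeta)=\sum_{r=1}^n\log h(\mathbf y^{(r)})$. For $\mathbf t\in\{0,1\}^d$ write $|\mathbf t|=t_1+\dots+t_d$, $b_m=b_m(\mathbf y,\mathbf t)=\Phi^{-1}(F_{Y_m}(y_m-t_m))$ and $H(\mathbf y-\mathbf t)=\Phi_d(\mathbf b;\mathbf 0,\mathbf P)$. **Scores.** For $1\le k\le d$, with $\mathcal T=\{1,\dots,d\}\setminus\{k\}$, define $$s_{\lambda_k}(\mathbf y)=\sum_{\mathbf t\in\{0,1\}^d}(-1)^{|\mathbf t|}\bigl(-f_{Y_k}(y_k-t_k)\bigr)\,\Phi_{d-1}\bigl(\mathbf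 b_{\mathcal T};\,\mathbf P_{\mathcal T,k}b_k,\ \mathbf P_{\mathcal T\mathcal T}-\mathbf P_{\mathcal T,k}\mathbf P_{\mathcal T,k}^\top\bigr),$$ a summand with $y_k-t_k<0$ being $0$. For $(i,j)\in\mathcal K$, with $S=\{1,\dots,d\}\setminus\{i,j\}$, define $$s_{\mathbf P}(\mathbf y)_{ij}=\sum_{\mathbf t\in\{0,1\}^d}(-1)^{|\mathbf t|}\varphi_2(b_i,b_j;\rho_{ij})\,\Phi_{d-2}\bigl(\mathbf b_S;\,\mathbf P_{S,ij}\mathbf P_{ij,ij}^{-1}(b_i,b_j)^\top,\ \mathbf P_{SS}-\mathbf P_{S,ij}\mathbf P_{ij,ij}^{-1}\mathbf P_{S,ij}^\top\bigr),$$ a summand with $b_i=-\infty$ or $b_j=-\infty$ being $0$. **Jacobian.** $\operatorname{vec}$ stacks the columns of a matrix, $\operatorname{vech}$ and $\operatorname{vechs}$ stack the columns of its lower triangular and strictly lower triangular part. $K_d$ is the commutation matrix ($K_d\operatorname{vec}A=\operatorname{vec}A^\top$), $D_d$ the duplication matrix ($D_d\operatorname{vech}A=\operatorname{vec}A$ for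 symmetric $A$), $D_d^+=(D_d^\top D_d)^{-1}D_d^\top$, and $M_p$ the selection matrix with $\operatorname{vechs}A=M_p\operatorname{vech}A$. $\mathbf e_i$ is the $i$-th canonical vector of $\mathbb R^d$. For $(i,m)\in\mathcal K$ let $\mathbf g_{im}\in\mathbb R^d$ have the entries $$(\mathbf g_{im})_j=\begin{cases}\mathbf 1_{m<j}\,q_{ij}\cot\omega_{im}\cos\omega_{ij}-\mathbf 1_{m=j}\,q_{i,j+1}, & j<i,\\ q_{ii}\cot\omega_{im}, & j=i,\\ 0,& j>i.\end{cases}$$ **Proposition.** For all $\eta$, $\zeta$ and all observations the following hold. 1. For every $r$, $h(\mathbf y^{(r)})>0$ and $h(\mathbf y^{(r)})=\sum_{\mathbf t\in\{0,1\}^d}(-1)^{|\mathbf t|}H(\mathbf y^{(r)}-\mathbf t)$. 2. For every $r$, regarding $h$ as a function of $\lambda$ and of $\operatorname{vechs}\mathbf P$ (with $\mathbf P$ symmetric with unit diagonal), $\partial h(\mathbf y^{(r)})/\partial\lambda_k=s_{\lambda_k}(\mathbf y^{(r)})$ for every $k$ and $\partial h(\mathbf y^{(r)})/\partial\rho_{ij}=s_{\mathbf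 P}(\mathbf y^{(r)})_{ij}$ for every $(i,j)\in\mathcal K$. 3. $(\mathbf g_{im})_j=\partial\alpha_{ij}/\partial\omega_{im}$ for all $(i,m)\in\mathcal K$ and all $j$. 4. $\ell$ is differentiable at $(\eta,\zeta)$ as a function on $\mathbb R^{d+p}$, and its gradient has the components $$\frac{\partial\ell}{\partial\eta_k}=\sum_{r=1}^n\frac{1}{h(\mathbf y^{(r)})}\,s_{\lambda_k}(\mathbf y^{(r)})\,e^{\eta_k}\qquad(1\le k\le d),$$ $$\frac{\partial\ell}{\partial\zeta_{ij}}=\sum_{r=1}^n\frac{1}{h(\mathbf y^{(r)})}\,\pi\Lambda(\zeta_{ij})\{1-\Lambda(\zeta_{ij})\}\;s_{\mathbf P}(\mathbf y^{(r)})^\top\bigl[M_pD_d^+(I_{d^2}+K_d)(I_d\otimes L)(\mathbf e_i\otimes\mathbf g_{ij})\bigr]\qquad((i,j)\in\mathcal K).$$ -/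

import Mathlib

open scoped Kronecker

noncomputable section

namespace GaussianPoisson

/-! ### Multivariate normal densities and distribution functions -/

/-- The density at `z` of the normal law on `ℝ^ι` with mean `μ` and positive definite covariance
matrix `S`. -/
def mvnDensity {ι : Type} [Fintype ι] [DecidableEq ι] (μ : ι → ℝ) (S : Matrix ι ι ℝ)
    (z : ι → ℝ) : ℝ :=
  Real.exp (-((z - μ) ⬝ᵥ (S⁻¹).mulVec (z - μ)) / 2) /
    (Real.sqrt (2 * Real.pi) ^ Fintype.card ι * Real.sqrt S.det)

/-- The normal distribution function `Φ(b; μ, S)` at a point `b` with coordinates in `[-∞, ∞]`.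
On an empty index type its value is `1`. -/
def mvnCdf {ι : Type} [Fintype ι] [DecidableEq ι] (b : ι → EReal) (μ : ι → ℝ)
    (S : Matrix ι ι ℝ) : ℝ :=
  ∫ z in {z : ι → ℝ | ∀ j, ((z j : ℝ) : EReal) ≤ b j}, mvnDensity μ S z

/-- The standard bivariate normal density with correlation `ρ`, extended by zero to points with an
infinite coordinate. -/
def phi2 (x y : EReal) (ρ : ℝ) : ℝ :=
  if x = ⊥ ∨ x = ⊤ ∨ y = ⊥ ∨ y = ⊤ then 0
  else mvnDensity 0 !![1, ρ; ρ, 1] ![x.toReal, y.toReal]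

/-- The standard normal quantile function `Φ⁻¹` with values in `[-∞, ∞]`; it takes the value `-∞`
at `0` and `+∞` at `1`. -/
def stdNormalQuantile (u : ℝ) : EReal :=
  sInf ((fun x : ℝ => (x : EReal)) ''
    {x : ℝ | u ≤ ProbabilityTheory.cdf (ProbabilityTheory.gaussianReal 0 1) x})

/-! ### Poisson margins -/

/-- The Poisson probability mass function at an integer (zero at negative integers). -/
def poissonPmf (l : ℝ) (m : ℤ) : ℝ :=
  (ProbabilityTheory.poissonMeasure l.toNNReal).real {k : ℕ | (k : ℤ) = m}

/-- The Poisson distribution function at an integer (zero at negative integers). -/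
def poissonCdf (l : ℝ) (m : ℤ) : ℝ :=
  (ProbabilityTheory.poissonMeasure l.toNNReal).real {k : ℕ | (k : ℤ) ≤ m}

/-- The point with coordinates `Φ⁻¹(F_j(x_j))`, where `F_j` is the Poisson distribution function
with mean `l j`. -/
def latent {d : ℕ} (l : Fin d → ℝ) (x : Fin d → ℤ) : Fin d → EReal :=
  fun j => stdNormalQuantile (poissonCdf (l j) (x j))

/-! ### The model -/

/-- The joint distribution function of the Gaussian copula model with Poisson margins. -/
def jointCdf {d : ℕ} (l : Fin d → ℝ) (P : Matrix (Fin d) (Fin d) ℝ) (x : Fin d → ℤ) : ℝ :=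
  mvnCdf (latent l x) 0 P

/-- The joint probability mass function at the count vector `y`: the integral of the centred
normal density with correlation matrix `P` over the rectangle with sides
`(Φ⁻¹(F_j(y_j - 1)), Φ⁻¹(F_j(y_j))]`. -/
def jointPmf {d : ℕ} (l : Fin d → ℝ) (P : Matrix (Fin d) (Fin d) ℝ) (y : Fin d → ℕ) : ℝ :=
  ∫ z in {z : Fin d → ℝ | ∀ j,
      latent l (fun i => (y i : ℤ) - 1) j < ((z j : ℝ) : EReal) ∧
        ((z j : ℝ) : EReal) ≤ latent l (fun i => (y i : ℤ)) j},
    mvnDensity 0 P z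

/-- The shifted count vector `y - t` for a corner `t ∈ {0,1}^d`. -/
def corner {d : ℕ} (y : Fin d → ℕ) (t : Fin d → Fin 2) : Fin d → ℤ :=
  fun j => (y j : ℤ) - ((t j : ℕ) : ℤ)

/-- The sign `(-1)^(t_1 + ⋯ + t_d)` of a corner. -/
def cornerSign {d : ℕ} (t : Fin d → Fin 2) : ℝ := (-1) ^ (∑ j, (t j : ℕ))

/-! ### Conditional normal parameters -/

/-- The indices other than `k`. -/
abbrev Rest1 {d : ℕ} (k : Fin d) : Type := {m : Fin d // m ≠ k}

/-- The indices other than `i` and `j`. -/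
abbrev Rest2 {d : ℕ} (i j : Fin d) : Type := {m : Fin d // m ≠ i ∧ m ≠ j}

/-- Conditional mean of the other coordinates given `Z_k = x`, under correlation matrix `P`. -/
def condMean1 {d : ℕ} (P : Matrix (Fin d) (Fin d) ℝ) (k : Fin d) (x : ℝ) : Rest1 k → ℝ :=
  fun m => P m k * x

/-- Conditional covariance of the other coordinates given `Z_k`. -/
def condCov1 {d : ℕ} (P : Matrix (Fin d) (Fin d) ℝ) (k : Fin d) :
    Matrix (Rest1 k) (Rest1 k) ℝ :=
  Matrix.of fun m m' => P m m' - P m k * P m' k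

/-- The block `P_{S,ij}` of `P`, with rows other than `i, j` and with columns `i, j`. -/
def crossBlock {d : ℕ} (P : Matrix (Fin d) (Fin d) ℝ) (i j : Fin d) :
    Matrix (Rest2 i j) (Fin 2) ℝ :=
  P.submatrix Subtype.val ![i, j]

/-- Conditional mean `P_{S,ij} P_{ij,ij}⁻¹ (x_i, x_j)ᵀ` given `Z_i = x 0` and `Z_j = x 1`. -/
def condMean2 {d : ℕ} (P : Matrix (Fin d) (Fin d) ℝ) (i j : Fin d) (x : Fin 2 → ℝ) :
    Rest2 i j → ℝ :=
  (crossBlock P i j * (P.submatrix ![i, j] ![i, j])⁻¹).mulVec x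

/-- Conditional covariance `P_{SS} - P_{S,ij} P_{ij,ij}⁻¹ P_{S,ij}ᵀ` given `Z_i` and `Z_j`. -/
def condCov2 {d : ℕ} (P : Matrix (Fin d) (Fin d) ℝ) (i j : Fin d) :
    Matrix (Rest2 i j) (Rest2 i j) ℝ :=
  P.submatrix Subtype.val Subtype.val -
    crossBlock P i j * (P.submatrix ![i, j] ![i, j])⁻¹ * (crossBlock P i j).transpose

/-! ### Matrix operators -/

/-- The strictly lower triangular index pairs `(i, j)`, `j < i`. -/
abbrev StrictLower (d : ℕ) : Type := {κ : Fin d × Fin d // κ.2 < κ.1}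

/-- The lower triangular index pairs `(i, j)`, `j ≤ i`. -/
abbrev Lower (d : ℕ) : Type := {κ : Fin d × Fin d // κ.2 ≤ κ.1}

/-- The half-vectorization. -/
def vech {d : ℕ} (A : Matrix (Fin d) (Fin d) ℝ) : Lower d → ℝ := fun κ => A κ.1.1 κ.1.2

/-- The strict half-vectorization. -/
def vechs {d : ℕ} (A : Matrix (Fin d) (Fin d) ℝ) : StrictLower d → ℝ := fun κ => A κ.1.1 κ.1.2

/-- The symmetric matrix with unit diagonal and given strictly lower triangular entries. -/
def corrMatrix {d : ℕ} (ϱ : StrictLower d → ℝ) : Matrix (Fin d) (Fin d) ℝ :=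
  Matrix.of fun i j =>
    if h : j < i then ϱ ⟨(i, j), h⟩ else if h : i < j then ϱ ⟨(j, i), h⟩ else 1

/-- The commutation matrix. -/
def commutation (d : ℕ) : Matrix (Fin d × Fin d) (Fin d × Fin d) ℝ :=
  Matrix.of fun p q => if p.1 = q.2 ∧ p.2 = q.1 then 1 else 0

/-- The duplication matrix. -/
def duplication (d : ℕ) : Matrix (Fin d × Fin d) (Lower d) ℝ :=
  Matrix.of fun p κ => if p = κ.1 ∨ p.swap = κ.1 then 1 else 0

/-- The matrix that selects the strictly lower triangular entries from a half-vectorization. -/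
def selection (d : ℕ) : Matrix (StrictLower d) (Lower d) ℝ :=
  Matrix.of fun κ p => if κ.1 = p.1 then 1 else 0

/-- The Moore-Penrose inverse `(DᵀD)⁻¹Dᵀ` of the duplication matrix. -/
def duplicationPinv (d : ℕ) : Matrix (Lower d) (Fin d × Fin d) ℝ :=
  ((duplication d).transpose * duplication d)⁻¹ * (duplication d).transpose

/-- The Kronecker product of two vectors. -/
def vecKron {d : ℕ} (u v : Fin d → ℝ) : Fin d × Fin d → ℝ := fun p => u p.1 * v p.2

theorem commutation_mulVec_vec {d : ℕ} (A : Matrix (Fin d) (Fin d) ℝ) :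
    (commutation d).mulVec A.vec = A.transpose.vec := by
  ext ⟨a, b⟩
  simp only [Matrix.mulVec, dotProduct, commutation, Matrix.of_apply, Matrix.vec,
    Matrix.transpose_apply]
  rw [Finset.sum_eq_single (b, a)]
  · simp
  · rintro ⟨x, y⟩ - h
    rw [if_neg, zero_mul]
    rintro ⟨h1, h2⟩
    exact h (by simp_all)
  · simp

theorem duplication_mulVec_vech {d : ℕ} (A : Matrix (Fin d) (Fin d) ℝ) (hA : A.IsSymm) :
    (duplication d).mulVec (vech A) = A.vec := by
  ext ⟨a, b⟩
  have hs : A a b = A b a := hA.apply b a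
  simp only [Matrix.mulVec, dotProduct, duplication, Matrix.of_apply, Matrix.vec, vech]
  rcases le_total b a with h | h
  · rw [Finset.sum_eq_single (⟨(a, b), h⟩ : Lower d)]
    · simp [hs]
    · rintro ⟨⟨x, y⟩, hxy⟩ - hne
      rw [if_neg, zero_mul]
      simp only [Prod.mk.injEq, Prod.swap_prod_mk, ne_eq, Subtype.mk.injEq] at *
      grind
    · simp
  · rw [Finset.sum_eq_single (⟨(b, a), h⟩ : Lower d)]
    · simp
    · rintro ⟨⟨x, y⟩, hxy⟩ - hne
      rw [if_neg, zero_mul]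
      simp only [Prod.mk.injEq, Prod.swap_prod_mk, ne_eq, Subtype.mk.injEq] at *
      grind
    · simp

theorem selection_mulVec_vech {d : ℕ} (A : Matrix (Fin d) (Fin d) ℝ) :
    (selection d).mulVec (vech A) = vechs A := by
  ext ⟨⟨a, b⟩, h⟩
  simp only [Matrix.mulVec, dotProduct, selection, Matrix.of_apply, vech, vechs]
  rw [Finset.sum_eq_single (⟨(a, b), le_of_lt h⟩ : Lower d)]
  · simp
  · rintro ⟨⟨x, y⟩, hxy⟩ - hne
    rw [if_neg, zero_mul]
    rintro h'
    exact hne (by simp_all)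
  · simp

/-! ### The spherical parametrization of correlation matrices -/

/-- The angle with index `(i, j)`; only used for `j < i`. -/
def angle {d : ℕ} (ω : StrictLower d → ℝ) (i j : Fin d) : ℝ :=
  if h : j < i then ω ⟨(i, j), h⟩ else 0

/-- The product of `sin ω_{ik}` over the first `m` columns `k`; only used for `m ≤ i`
(indices start at `0`). -/
def sinProd {d : ℕ} (ω : StrictLower d → ℝ) (i : Fin d) (m : ℕ) : ℝ :=
  ∏ k : Fin d with k.val < m, Real.sin (angle ω i k)

/-- The lower triangular matrix with the given spherical angles. -/
def cholesky {d : ℕ} (ω : StrictLower d → ℝ) : Matrix (Fin d) (Fin d) ℝ :=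
  Matrix.of fun i j =>
    if j < i then sinProd ω i j * Real.cos (angle ω i j)
    else if j = i then sinProd ω i i
    else 0

/-- The vector `g_{im}`, `κ = (i, m)`, in closed form. -/
def rowGrad {d : ℕ} (ω : StrictLower d → ℝ) (κ : StrictLower d) : Fin d → ℝ := fun j =>
  if j < κ.1.1 then
    (if κ.1.2 < j then
      sinProd ω κ.1.1 j * Real.cot (ω κ) * Real.cos (angle ω κ.1.1 j) else 0) -
    (if κ.1.2 = j then sinProd ω κ.1.1 (j.val + 1) else 0)
  else if j = κ.1.1 then sinProd ω κ.1.1 κ.1.1 * Real.cot (ω κ)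
  else 0

/-- The angles `ω = π Λ(ζ)`, with `Λ` the logistic function. -/
def angles {d : ℕ} (ζ : StrictLower d → ℝ) : StrictLower d → ℝ :=
  fun κ => Real.pi * Real.sigmoid (ζ κ)

/-- The lower triangular factor as a function of the unconstrained parameters. -/
def lfac {d : ℕ} (ζ : StrictLower d → ℝ) : Matrix (Fin d) (Fin d) ℝ := cholesky (angles ζ)

/-- The correlation matrix `P = L Lᵀ` as a function of the unconstrained parameters. -/
def scp {d : ℕ} (ζ : StrictLower d → ℝ) : Matrix (Fin d) (Fin d) ℝ :=
  lfac ζ * (lfac ζ).transpose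

/-! ### Likelihood and scores -/

/-- The Poisson means `λ = exp η`. -/
def means {d : ℕ} (η : Fin d → ℝ) : Fin d → ℝ := fun k => Real.exp (η k)

/-- The log-likelihood of the sample `y 0, …, y (n - 1)` as a function of the unconstrained
parameter vector `ψ = (η, ζ)`. -/
def logLik {d n : ℕ} (y : Fin n → Fin d → ℕ)
    (ψ : EuclideanSpace ℝ (Fin d ⊕ StrictLower d)) : ℝ :=
  ∑ r, Real.log
    (jointPmf (means fun k => ψ (Sum.inl k)) (scp fun κ => ψ (Sum.inr κ)) (y r))

/-- The score of the probability mass function in the `k`-th Poisson mean. -/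
def meanScore {d : ℕ} (l : Fin d → ℝ) (P : Matrix (Fin d) (Fin d) ℝ) (y : Fin d → ℕ)
    (k : Fin d) : ℝ :=
  ∑ t : Fin d → Fin 2, cornerSign t * (-poissonPmf (l k) (corner y t k)) *
    mvnCdf (fun m : Rest1 k => latent l (corner y t) m)
      (condMean1 P k (latent l (corner y t) k).toReal) (condCov1 P k)

/-- The score of the probability mass function in the correlations `ρ_{ij}`, `κ = (i, j)`. -/
def corrScore {d : ℕ} (l : Fin d → ℝ) (P : Matrix (Fin d) (Fin d) ℝ) (y : Fin d → ℕ)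
    (κ : StrictLower d) : ℝ :=
  ∑ t : Fin d → Fin 2, cornerSign t *
    phi2 (latent l (corner y t) κ.1.1) (latent l (corner y t) κ.1.2) (P κ.1.1 κ.1.2) *
    mvnCdf (fun m : Rest2 κ.1.1 κ.1.2 => latent l (corner y t) m)
      (condMean2 P κ.1.1 κ.1.2
        ![(latent l (corner y t) κ.1.1).toReal, (latent l (corner y t) κ.1.2).toReal])
      (condCov2 P κ.1.1 κ.1.2)

/-- The derivative of `vechs P` in the angle `ω_{ij}`, `κ = (i, j)`:
`M D⁺ (I + K) (I ⊗ L) (e_i ⊗ g_{ij})`. -/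
def vechsJacobian {d : ℕ} (ζ : StrictLower d → ℝ) (κ : StrictLower d) : StrictLower d → ℝ :=
  (selection d * duplicationPinv d * (1 + commutation d) *
      ((1 : Matrix (Fin d) (Fin d) ℝ) ⊗ₖ lfac ζ)).mulVec
    (vecKron (Pi.single κ.1.1 1) (rowGrad (angles ζ) κ))

end GaussianPoisson

end

open GaussianPoisson

namespace GaussianPoisson

open MeasureTheory Filter Topology

/-! The mass function is an alternating sum of orthant probabilities $\Phi_d(b;0,P)$ with
$b_j=\Phi^{-1}(F_{Y_j}(y_j-t_j))$, so everything rests on the total derivative of $\Phi_d(b;0,P)$ in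
$(b,\operatorname{vechs}P)$. Translating the orthant to a fixed one gives $\int_{u\le
0}\varphi_P(u+b)\,du$. Its integrand is the exponential of a combination of finitely many monomials
in $u$ of degree at most two, with coefficients that are $C^1$ in $(b,P)$, and Gaussian tails that
are locally uniform in the parameters permit differentiation under the integral
(`hasFDerivAt_setIntegral_mvnDensity_add`).

The partial derivatives are then orthant integrals of derivatives of $\varphi_P$: of
$\partial_k\varphi_P$ for $b_k$, and of $\partial_i\partial_j\varphi_P$ for $\rho_{ij}$, by
Plackett's identity (`hasDerivAt_mvnDensity_add_smul_single`). Integrating along the one or two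
differentiated coordinates leaves the density on the slice $z_k=b_k$ or $(z_i,z_j)=(b_i,b_j)$, which
factors into a marginal and a conditional density (`mvnDensity_fromBlocks`). This yields
$\varphi(b_k)\Phi_{d-1}$ and $\varphi_2\Phi_{d-2}$. Since $\partial F_Y(m)/\partial\lambda=-f_Y(m)$,
the chain factor is $\partial b_k/\partial\lambda_k=-f_{Y_k}/\varphi(b_k)$, and $\varphi(b_k)$
cancels. A corner with a negative count contributes zero identically
(`exists_hasFDerivAt_jointCdf`).

On the side of the parametrization, the angles lie in $(0,\pi)$, so all their sines are positive,
$L$ is invertible with unit rows, and $P$ is a positive definite correlation matrix. The angle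
$\omega_{im}$ moves only row $i$ of $L$, so the derivative of $P$ is $e_i(Lg)^\top+(Lg)e_i^\top$;
`vechsJacobian_apply` recognises the Kronecker formula as the strict half-vectorization of this
matrix. Positivity of $h$ and the chain rule for total derivatives give the gradient. -/

/-! ### Gaussian majorants and differentiation under the integral sign -/

theorem integrable_exp_neg_sum_sq {ι : Type} [Fintype ι] {c : ℝ} (hc : 0 < c) :
    Integrable fun u : ι → ℝ => Real.exp (-c * ∑ i, u i ^ 2) := by
  have h : (fun u : ι → ℝ => Real.exp (-c * ∑ i, u i ^ 2)) =
      fun u => ∏ i, Real.exp (-c * u i ^ 2) := by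
    funext u
    rw [← Real.exp_sum, Finset.mul_sum]
  rw [h]
  exact Integrable.fintype_prod (f := fun _ x => Real.exp (-c * x ^ 2))
    fun _ => integrable_exp_neg_mul_sq hc

/-- Half of the exponent absorbs the polynomial factor, since $e^{cs/2}$ dominates both $1$ and
$cs/2$. -/
theorem one_add_mul_exp_le {c s : ℝ} (hc : 0 < c) (hs : 0 ≤ s) :
    (1 + s) * Real.exp (-c * s) ≤ (1 + 2 / c) * Real.exp (-(c / 2) * s) := by
  have h1 : Real.exp (-c * s) = Real.exp (-(c / 2) * s) * Real.exp (-(c / 2) * s) := by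
    rw [← Real.exp_add]; ring_nf
  have h2 : (1 + s) * Real.exp (-(c / 2) * s) ≤ 1 + 2 / c := by
    have h3 : c / 2 * s ≤ Real.exp (c / 2 * s) := by
      linarith [Real.add_one_le_exp (c / 2 * s)]
    have h4 : Real.exp (-(c / 2) * s) = (Real.exp (c / 2 * s))⁻¹ := by
      rw [← Real.exp_neg]; ring_nf
    have h5 : 1 ≤ Real.exp (c / 2 * s) := Real.one_le_exp (by positivity)
    rw [h4, ← div_eq_mul_inv, div_le_iff₀ (by positivity)]
    have h6 : s ≤ 2 / c * Real.exp (c / 2 * s) := by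
      calc s = 2 / c * (c / 2 * s) := by field_simp
        _ ≤ _ := by gcongr
    linarith
  calc _ = ((1 + s) * Real.exp (-(c / 2) * s)) * Real.exp (-(c / 2) * s) := by rw [h1]; ring
    _ ≤ _ := by gcongr

theorem integrable_one_add_mul_exp_neg_sum_sq {ι : Type} [Fintype ι] {c : ℝ} (hc : 0 < c) :
    Integrable fun u : ι → ℝ => (1 + ∑ i, u i ^ 2) * Real.exp (-c * ∑ i, u i ^ 2) := by
  refine ((integrable_exp_neg_sum_sq (ι := ι) (half_pos hc)).const_mul (1 + 2 / c)).mono'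
    (by fun_prop) (ae_of_all _ fun u => ?_)
  have h : 0 ≤ ∑ i, u i ^ 2 := Finset.sum_nonneg fun _ _ => sq_nonneg _
  rw [Real.norm_of_nonneg (by positivity)]
  exact one_add_mul_exp_le hc h

/-- The parameter enters only through finitely many $C^1$ coefficients. Near $p_0$ their derivatives
are bounded by their norms at $p_0$ plus one, so the derivative of the integrand is dominated by a
constant multiple of $wB$, uniformly in $p$. -/
theorem hasFDerivAt_integral_exp_sum {E : Type*} [NormedAddCommGroup E] [NormedSpace ℝ E]
    {X : Type*} [MeasurableSpace X] {μ : Measure X} {J : Type*} [Fintype J]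
    {a : J → E → ℝ} {m : J → X → ℝ} {p₀ : E} {w B : X → ℝ}
    (ha : ∀ α, ContDiffAt ℝ 1 (a α) p₀) (hm : ∀ α, Measurable (m α))
    (hmw : ∀ α x, |m α x| ≤ w x)
    (hB : ∀ᶠ p in 𝓝 p₀, ∀ x, Real.exp (∑ α, a α p * m α x) ≤ B x)
    (hBi : Integrable B μ) (hwB : Integrable (fun x => w x * B x) μ) :
    Integrable (fun x => Real.exp (∑ α, a α p₀ * m α x) •
      ∑ α, m α x • fderiv ℝ (a α) p₀) μ ∧
    HasFDerivAt (fun p => ∫ x, Real.exp (∑ α, a α p * m α x) ∂μ)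
      (∫ x, Real.exp (∑ α, a α p₀ * m α x) • ∑ α, m α x • fderiv ℝ (a α) p₀ ∂μ) p₀ := by
  set K : ℝ := ∑ α, (‖fderiv ℝ (a α) p₀‖ + 1) with hK
  have hmeas : ∀ p, AEStronglyMeasurable (fun x => Real.exp (∑ α, a α p * m α x)) μ := fun p =>
    (Real.measurable_exp.comp
      (Finset.measurable_sum _ fun α _ => (hm α).const_mul _)).aestronglyMeasurable
  have hmeas' : AEStronglyMeasurable (fun x => Real.exp (∑ α, a α p₀ * m α x) •
      ∑ α, m α x • fderiv ℝ (a α) p₀) μ := by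
    refine (hmeas p₀).smul ?_
    refine Finset.aestronglyMeasurable_fun_sum _ fun α _ => ?_
    exact (hm α).aestronglyMeasurable.smul aestronglyMeasurable_const
  have hev : ∀ᶠ p in 𝓝 p₀, (∀ x, Real.exp (∑ α, a α p * m α x) ≤ B x) ∧
      ∀ α, DifferentiableAt ℝ (a α) p ∧ ‖fderiv ℝ (a α) p‖ ≤ ‖fderiv ℝ (a α) p₀‖ + 1 := by
    refine hB.and (eventually_all.2 fun α => ?_)
    have h1 : ∀ᶠ p in 𝓝 p₀, ContDiffAt ℝ 1 (a α) p := (ha α).eventually (by simp)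
    have h2 : ContinuousAt (fun p => ‖fderiv ℝ (a α) p‖) p₀ :=
      (((ha α).fderiv_right (m := 0) (by simp)).continuousAt).norm
    have h3 := h2.eventually_lt_const (lt_add_one _)
    filter_upwards [h1, h3] with p h1 h3
    exact ⟨h1.differentiableAt (by simp), h3.le⟩
  have hbound : ∀ p, (∀ x, Real.exp (∑ α, a α p * m α x) ≤ B x) →
      (∀ α, DifferentiableAt ℝ (a α) p ∧ ‖fderiv ℝ (a α) p‖ ≤ ‖fderiv ℝ (a α) p₀‖ + 1) →
      ∀ x, ‖Real.exp (∑ α, a α p * m α x) • ∑ α, m α x • fderiv ℝ (a α) p‖ ≤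
        K * (w x * B x) := by
    intro p h1 h2 x
    rw [norm_smul, Real.norm_of_nonneg (Real.exp_pos _).le]
    have h3 : ‖∑ α, m α x • fderiv ℝ (a α) p‖ ≤ w x * K := by
      rw [hK, Finset.mul_sum]
      refine (norm_sum_le _ _).trans (Finset.sum_le_sum fun α _ => ?_)
      rw [norm_smul]
      exact mul_le_mul (hmw α x) (h2 α).2 (norm_nonneg _) ((abs_nonneg _).trans (hmw α x))
    calc _ ≤ B x * (w x * K) := mul_le_mul (h1 x) h3 (norm_nonneg _)
          ((Real.exp_pos _).le.trans (h1 x))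
      _ = _ := by ring
  have hKB : Integrable (fun x => K * (w x * B x)) μ := hwB.const_mul K
  obtain ⟨h1, h2⟩ := hev.self_of_nhds
  refine ⟨hKB.mono' hmeas' (ae_of_all _ (hbound p₀ h1 h2)), ?_⟩
  refine hasFDerivAt_integral_of_dominated_of_fderiv_le (s := {p | _ ∧ _}) hev
    (F' := fun p x => Real.exp (∑ α, a α p * m α x) • ∑ α, m α x • fderiv ℝ (a α) p)
    (Eventually.of_forall hmeas) ?_ hmeas'
    (ae_of_all _ fun x p hp => hbound p hp.1 hp.2 x) hKB (ae_of_all _ fun x p hp => ?_)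
  · refine hBi.mono' (hmeas p₀) (ae_of_all _ fun x => ?_)
    rw [Real.norm_of_nonneg (Real.exp_pos _).le]
    exact h1 x
  · refine HasFDerivAt.exp ?_
    refine HasFDerivAt.fun_sum fun α _ => ?_
    exact ((hp.2 α).1.hasFDerivAt).mul_const (m α x)

/-! ### Quadratic forms and Gaussian tails -/

theorem quadForm_le_of_entries_le {ι : Type} [Fintype ι] {P : Matrix ι ι ℝ} {K : ℝ}
    (h : ∀ i j, |P i j| ≤ K)
    (x : ι → ℝ) : x ⬝ᵥ P.mulVec x ≤ K * Fintype.card ι * ∑ i, x i ^ 2 := by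
  have h1 : ∀ i j, x i * (P i j * x j) ≤ K / 2 * x i ^ 2 + K / 2 * x j ^ 2 := by
    intro i j
    have hK : 0 ≤ K := (abs_nonneg _).trans (h i j)
    have h2 : x i * (P i j * x j) ≤ |P i j| * (|x i| * |x j|) := by
      rw [← abs_mul, ← abs_mul]
      exact (le_of_eq (by ring)).trans (le_abs_self _)
    have h3 : |P i j| * (|x i| * |x j|) ≤ K * (|x i| * |x j|) := by
      gcongr
      exact h i j
    have h4 : |x i| * |x j| ≤ (x i ^ 2 + x j ^ 2) / 2 := by
      nlinarith [sq_nonneg (|x i| - |x j|), sq_abs (x i), sq_abs (x j)]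
    nlinarith
  calc x ⬝ᵥ P.mulVec x = ∑ i, ∑ j, x i * (P i j * x j) := by
        simp [dotProduct, Matrix.mulVec, Finset.mul_sum]
    _ ≤ ∑ i, ∑ j, (K / 2 * x i ^ 2 + K / 2 * x j ^ 2) :=
        Finset.sum_le_sum fun i _ => Finset.sum_le_sum fun j _ => h1 i j
    _ = K * Fintype.card ι * ∑ i, x i ^ 2 := by
        simp only [Finset.sum_add_distrib, Finset.sum_const, Finset.card_univ, nsmul_eq_mul,
          ← Finset.mul_sum]
        ring

/-- Coordinatewise the difference of the two sides is $(u_i+2b_i)^2/2$. A shift in a Gaussian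
exponent thus costs half of the exponent and a constant. -/
theorem sum_sq_add_ge {ι : Type} [Fintype ι] (u b : ι → ℝ) :
    (∑ i, u i ^ 2) / 2 - ∑ i, b i ^ 2 ≤ ∑ i, (u i + b i) ^ 2 := by
  rw [Finset.sum_div, ← Finset.sum_sub_distrib]
  exact Finset.sum_le_sum fun i _ => by nlinarith [sq_nonneg (u i + 2 * b i)]

/-- The monomials of degree at most two. -/
noncomputable def monomial₂ {ι : Type} (s : Option ι × Option ι) (u : ι → ℝ) : ℝ :=
  s.1.elim 1 u * s.2.elim 1 u

theorem abs_monomial₂_le {ι : Type} [Fintype ι] (s : Option ι × Option ι) (u : ι → ℝ) :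
    |monomial₂ s u| ≤ 1 + ∑ i, u i ^ 2 := by
  have h : ∀ i, u i ^ 2 ≤ ∑ i, u i ^ 2 := fun i =>
    Finset.single_le_sum (f := fun i => u i ^ 2) (fun _ _ => sq_nonneg _) (Finset.mem_univ i)
  have h0 : 0 ≤ ∑ i, u i ^ 2 := Finset.sum_nonneg fun _ _ => sq_nonneg _
  obtain ⟨_ | m, _ | n⟩ := s
  · simpa [monomial₂] using h0
  · simp only [monomial₂, Option.elim, one_mul]
    nlinarith [h n, sq_nonneg (|u n| - 1), sq_abs (u n)]
  · simp only [monomial₂, Option.elim, mul_one]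
    nlinarith [h m, sq_nonneg (|u m| - 1), sq_abs (u m)]
  · simp only [monomial₂, Option.elim, abs_mul]
    nlinarith [h m, h n, sq_nonneg (|u m| - |u n|), sq_abs (u m), sq_abs (u n)]

theorem measurable_monomial₂ {ι : Type} (s : Option ι × Option ι) : Measurable (monomial₂ s) := by
  unfold monomial₂
  obtain ⟨_ | m, _ | n⟩ := s <;> simp only [Option.elim] <;> fun_prop

section QuadraticForm

variable {ι : Type} [Fintype ι] [DecidableEq ι]

/-- With $y=P^{-1}x$, positivity of the form of $P$ at $y-x/c$ reads $0\le x\cdot y-2|x|^2/c+x^\top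
Px/c^2$, and the last term is at most $|x|^2/c$. No eigenvalues are needed. -/
theorem sum_sq_div_le_inv_quadForm {P : Matrix ι ι ℝ} (hP : P.PosDef) {c : ℝ} (hc : 0 < c)
    (h : ∀ x : ι → ℝ, x ⬝ᵥ P.mulVec x ≤ c * ∑ i, x i ^ 2) (x : ι → ℝ) :
    (∑ i, x i ^ 2) / c ≤ x ⬝ᵥ (P⁻¹).mulVec x := by
  have hs : P.transpose = P := by simpa using hP.isHermitian.eq
  have hdet : IsUnit P.det := hP.det_pos.ne'.isUnit
  set y := (P⁻¹).mulVec x with hy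
  have hPy : P.mulVec y = x := by
    rw [hy, Matrix.mulVec_mulVec, Matrix.mul_nonsing_inv _ hdet, Matrix.one_mulVec]
  have hyP : y ⬝ᵥ P.mulVec x = x ⬝ᵥ x := by
    rw [Matrix.dotProduct_mulVec, ← Matrix.mulVec_transpose, hs, hPy]
  have hxx : x ⬝ᵥ x = ∑ i, x i ^ 2 := by simp [dotProduct, sq]
  have h0 : 0 ≤ (y - c⁻¹ • x) ⬝ᵥ P.mulVec (y - c⁻¹ • x) := by
    simpa using hP.posSemidef.dotProduct_mulVec_nonneg (y - c⁻¹ • x)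
  rw [Matrix.mulVec_sub, Matrix.mulVec_smul, hPy] at h0
  simp only [sub_dotProduct, dotProduct_sub, smul_dotProduct, dotProduct_smul, smul_eq_mul, hyP,
    hxx] at h0
  have h1 : c⁻¹ * (c⁻¹ * (x ⬝ᵥ P.mulVec x)) ≤ c⁻¹ * (c⁻¹ * (c * ∑ i, x i ^ 2)) := by
    gcongr
    exact h x
  have h2 : c⁻¹ * (c⁻¹ * (c * ∑ i, x i ^ 2)) = c⁻¹ * ∑ i, x i ^ 2 := by field_simp
  rw [dotProduct_comm y x] at h0
  rw [div_eq_inv_mul]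
  linarith

/-- The added `1` keeps the divisor positive when `K = 0` or the index type is empty. -/
theorem inv_quadForm_ge_of_entries_le {P : Matrix ι ι ℝ} (hP : P.PosDef) {K : ℝ} (hK : 0 ≤ K)
    (h : ∀ i j, |P i j| ≤ K) (x : ι → ℝ) :
    (∑ i, x i ^ 2) / (K * Fintype.card ι + 1) ≤ x ⬝ᵥ (P⁻¹).mulVec x := by
  refine sum_sq_div_le_inv_quadForm hP (by positivity) (fun x => ?_) x
  have h1 := quadForm_le_of_entries_le h x
  have h2 : 0 ≤ ∑ i, x i ^ 2 := Finset.sum_nonneg fun _ _ => sq_nonneg _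
  linarith

/-- Moving the normalizing constant into the exponent makes the density a pure exponential, as the
exponential-family form requires. -/
theorem mvnDensity_zero_eq_exp {P : Matrix ι ι ℝ} (hP : 0 < P.det) (z : ι → ℝ) :
    mvnDensity 0 P z = Real.exp (-(z ⬝ᵥ (P⁻¹).mulVec z) / 2 -
      (Fintype.card ι * Real.log (Real.sqrt (2 * Real.pi)) + Real.log P.det / 2)) := by
  have h1 : 0 < Real.sqrt (2 * Real.pi) := by positivity
  have h2 : 0 < Real.sqrt P.det := Real.sqrt_pos.2 hP
  rw [mvnDensity, sub_zero, Real.exp_sub]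
  congr 1
  rw [← Real.log_sqrt hP.le, ← Real.log_pow, ← Real.log_mul (by positivity) h2.ne',
    Real.exp_log (by positivity)]

theorem mvnDensity_pos {P : Matrix ι ι ℝ} (hP : 0 < P.det) (μ z : ι → ℝ) :
    0 < mvnDensity μ P z := by
  have h2 : 0 < Real.sqrt P.det := Real.sqrt_pos.2 hP
  unfold mvnDensity
  positivity

@[fun_prop]
theorem continuous_mvnDensity (μ : ι → ℝ) (P : Matrix ι ι ℝ) : Continuous (mvnDensity μ P) := by
  unfold mvnDensity
  fun_prop

/-- The exponential factor depends on `P` and `b` only through the bounds `K` and `R`, and the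
prefactor only through these and the determinant. This is the tail bound that is uniform near a
given parameter. -/
theorem mvnDensity_add_le {P : Matrix ι ι ℝ} (hP : P.PosDef) {K R : ℝ} (hK : 0 ≤ K)
    (h : ∀ i j, |P i j| ≤ K) {b : ι → ℝ} (hb : ∑ i, b i ^ 2 ≤ R) (u : ι → ℝ) :
    mvnDensity 0 P (u + b) ≤
      (Real.exp (R / (2 * (K * Fintype.card ι + 1))) /
        (Real.sqrt (2 * Real.pi) ^ Fintype.card ι * Real.sqrt P.det)) *
      Real.exp (-(1 / (4 * (K * Fintype.card ι + 1))) * ∑ i, u i ^ 2) := by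
  have h2 : 0 < Real.sqrt P.det := Real.sqrt_pos.2 hP.det_pos
  rw [mvnDensity, sub_zero, div_mul_eq_mul_div, ← Real.exp_add]
  gcongr
  have h3 := inv_quadForm_ge_of_entries_le hP hK h (u + b)
  have h4 := sum_sq_add_ge u b
  have hc : 0 < K * Fintype.card ι + 1 := by positivity
  simp only [Pi.add_apply] at h3
  have h5 : ((∑ i, u i ^ 2) / 2 - R) / (K * Fintype.card ι + 1) ≤
      (∑ i, (u i + b i) ^ 2) / (K * Fintype.card ι + 1) := by
    gcongr
    linarith
  have h6 : R / (2 * (K * Fintype.card ι + 1)) +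
      -(1 / (4 * (K * Fintype.card ι + 1))) * ∑ i, u i ^ 2 =
      -(((∑ i, u i ^ 2) / 2 - R) / (K * Fintype.card ι + 1)) / 2 := by
    field_simp
    ring
  rw [h6]
  linarith

/-- A centred nondegenerate normal density has Gaussian tails. -/
theorem exists_mvnDensity_le {P : Matrix ι ι ℝ} (hP : P.PosDef) :
    ∃ C c : ℝ, 0 < C ∧ 0 < c ∧ ∀ z, mvnDensity 0 P z ≤ C * Real.exp (-c * ∑ i, z i ^ 2) := by
  set K : ℝ := ∑ i, ∑ j, |P i j| with hK
  have hK0 : 0 ≤ K := by positivity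
  have h : ∀ i j, |P i j| ≤ K := fun i j =>
    (Finset.single_le_sum (f := fun j => |P i j|) (fun _ _ => abs_nonneg _)
      (Finset.mem_univ j)).trans (Finset.single_le_sum (f := fun i => ∑ j, |P i j|)
        (fun _ _ => by positivity) (Finset.mem_univ i))
  have h2 : 0 < Real.sqrt P.det := Real.sqrt_pos.2 hP.det_pos
  refine ⟨1 / (Real.sqrt (2 * Real.pi) ^ Fintype.card ι * Real.sqrt P.det),
    1 / (4 * (K * Fintype.card ι + 1)), by positivity, by positivity, fun z => ?_⟩
  simpa using mvnDensity_add_le hP hK0 h (b := 0) (R := 0) (by simp) z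

theorem integrable_mvnDensity_zero {P : Matrix ι ι ℝ} (hP : P.PosDef) :
    Integrable (mvnDensity 0 P) := by
  obtain ⟨C, c, -, hc, h⟩ := exists_mvnDensity_le hP
  refine ((integrable_exp_neg_sum_sq hc).const_mul C).mono'
    (continuous_mvnDensity _ _).aestronglyMeasurable (ae_of_all _ fun z => ?_)
  rw [Real.norm_of_nonneg (mvnDensity_pos hP.det_pos _ _).le]
  exact h z

end QuadraticForm

/-! ### Smooth dependence of translated normal densities on their parameters -/

section Smooth

variable {ι : Type} [Fintype ι] [DecidableEq ι] {E : Type*} [NormedAddCommGroup E]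
  [NormedSpace ℝ E] {A : E → Matrix ι ι ℝ} {p₀ : E}

theorem contDiffAt_det (hA : ∀ i j, ContDiffAt ℝ 1 (fun p => A p i j) p₀) :
    ContDiffAt ℝ 1 (fun p => (A p).det) p₀ := by
  simp only [Matrix.det_apply']
  exact ContDiffAt.sum fun σ _ => contDiffAt_const.mul (contDiffAt_prod fun i _ => hA _ _)

theorem contDiffAt_adjugate_apply (hA : ∀ i j, ContDiffAt ℝ 1 (fun p => A p i j) p₀) (i j : ι) :
    ContDiffAt ℝ 1 (fun p => (A p).adjugate i j) p₀ := by
  simp only [Matrix.adjugate_apply]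
  refine contDiffAt_det fun k l => ?_
  by_cases hk : k = j
  · subst hk
    simp only [Matrix.updateRow_self]
    exact contDiffAt_const
  · simp only [Matrix.updateRow_ne hk]
    exact hA k l

/-- Cramer's rule: the inverse is the adjugate, polynomial in the entries, divided by the
determinant. -/
theorem contDiffAt_matrix_inv_apply (hA : ∀ i j, ContDiffAt ℝ 1 (fun p => A p i j) p₀)
    (h0 : (A p₀).det ≠ 0) (i j : ι) : ContDiffAt ℝ 1 (fun p => (A p)⁻¹ i j) p₀ := by
  simp only [Matrix.inv_def, Ring.inverse_eq_inv', Matrix.smul_apply, smul_eq_mul]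
  exact ((contDiffAt_det hA).inv h0).mul (contDiffAt_adjugate_apply hA i j)

/-- The natural parameters of the family of translated normal densities
`u ↦ φ(u + b; 0, P)`, seen as an exponential family in the monomials of degree at most two. -/
noncomputable def naturalParam (P : Matrix ι ι ℝ) (b : ι → ℝ) : Option ι × Option ι → ℝ
  | (some m, some n) => -(1 / 2) * P⁻¹ m n
  | (some m, none) => -(1 / 2) * ∑ n, P⁻¹ m n * b n
  | (none, some n) => -(1 / 2) * ∑ m, P⁻¹ m n * b m
  | (none, none) => -(1 / 2) * (∑ m, ∑ n, P⁻¹ m n * b m * b n) -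
      (Fintype.card ι * Real.log (Real.sqrt (2 * Real.pi)) + Real.log P.det / 2)

/-- Expanding $(u+b)^\top P^{-1}(u+b)$ separates the variable $u$ from the parameters. The linear
part appears in two halves, one for each position of `none` in the index pair. -/
theorem mvnDensity_add_eq_exp_sum {P : Matrix ι ι ℝ} (hP : 0 < P.det) (u b : ι → ℝ) :
    mvnDensity 0 P (u + b) = Real.exp (∑ s, naturalParam P b s * monomial₂ s u) := by
  rw [mvnDensity_zero_eq_exp hP]
  congr 1
  simp only [Fintype.sum_prod_type, Fintype.sum_option, monomial₂, naturalParam, Option.elim,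
    dotProduct, Matrix.mulVec, Pi.add_apply, mul_one, one_mul]
  have h1 : ∀ m, (u m + b m) * ∑ n, P⁻¹ m n * (u n + b n) = ∑ n, P⁻¹ m n * b m * b n +
      (∑ n, P⁻¹ m n * b m * u n + ((∑ n, P⁻¹ m n * b n) * u m + ∑ n, P⁻¹ m n * u m * u n)) := by
    intro m
    rw [Finset.mul_sum, Finset.sum_mul, ← Finset.sum_add_distrib, ← Finset.sum_add_distrib,
      ← Finset.sum_add_distrib]
    exact Finset.sum_congr rfl fun n _ => by ring
  have h2 : ∑ n, -(1 / 2) * (∑ m, P⁻¹ m n * b m) * u n =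
      -(1 / 2) * ∑ m, ∑ n, P⁻¹ m n * b m * u n := by
    rw [Finset.sum_comm, Finset.mul_sum]
    exact Finset.sum_congr rfl fun n _ => by rw [mul_assoc, Finset.sum_mul]
  have h3 : ∑ m, (-(1 / 2) * (∑ n, P⁻¹ m n * b n) * u m + ∑ n, -(1 / 2) * P⁻¹ m n * (u m * u n)) =
      -(1 / 2) * ∑ m, ((∑ n, P⁻¹ m n * b n) * u m + ∑ n, P⁻¹ m n * u m * u n) := by
    rw [Finset.mul_sum]
    refine Finset.sum_congr rfl fun m _ => ?_
    have h4 : ∑ n, -(1 / 2) * P⁻¹ m n * (u m * u n) = -(1 / 2) * ∑ n, P⁻¹ m n * u m * u n := by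
      rw [Finset.mul_sum]
      exact Finset.sum_congr rfl fun n _ => by ring
    rw [h4]
    ring
  rw [h2, h3]
  simp only [h1, Finset.sum_add_distrib]
  ring

variable {P : E → Matrix ι ι ℝ} {b : E → ι → ℝ}

theorem contDiffAt_naturalParam (hP : ∀ i j, ContDiffAt ℝ 1 (fun p => P p i j) p₀)
    (hb : ∀ i, ContDiffAt ℝ 1 (fun p => b p i) p₀) (h0 : (P p₀).det ≠ 0)
    (s : Option ι × Option ι) : ContDiffAt ℝ 1 (fun p => naturalParam (P p) (b p) s) p₀ := by
  have hQ := contDiffAt_matrix_inv_apply hP h0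
  obtain ⟨_ | m, _ | n⟩ := s <;> simp only [naturalParam]
  · refine (contDiffAt_const.mul (ContDiffAt.sum fun m _ => ContDiffAt.sum fun n _ =>
      ((hQ m n).mul (hb m)).mul (hb n))).sub (contDiffAt_const.add ?_)
    exact ((contDiffAt_det hP).log h0).div_const 2
  · exact contDiffAt_const.mul (ContDiffAt.sum fun m _ => (hQ m n).mul (hb m))
  · exact contDiffAt_const.mul (ContDiffAt.sum fun n _ => (hQ m n).mul (hb n))
  · exact contDiffAt_const.mul (hQ m n)

/-- Differentiation under the integral sign for translated normal densities. -/
theorem hasFDerivAt_setIntegral_mvnDensity_add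
    (hP : ∀ i j, ContDiffAt ℝ 1 (fun p => P p i j) p₀)
    (hb : ∀ i, ContDiffAt ℝ 1 (fun p => b p i) p₀) (hpos : ∀ᶠ p in 𝓝 p₀, (P p).PosDef)
    (s : Set (ι → ℝ)) :
    (∀ u, DifferentiableAt ℝ (fun p => mvnDensity 0 (P p) (u + b p)) p₀) ∧
    IntegrableOn (fun u => fderiv ℝ (fun p => mvnDensity 0 (P p) (u + b p)) p₀) s ∧
    HasFDerivAt (fun p => ∫ u in s, mvnDensity 0 (P p) (u + b p))
      (∫ u in s, fderiv ℝ (fun p => mvnDensity 0 (P p) (u + b p)) p₀) p₀ := by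
  have hdet₀ : 0 < (P p₀).det := hpos.self_of_nhds.det_pos
  have ha := contDiffAt_naturalParam hP hb hdet₀.ne'
  have heq : ∀ᶠ p in 𝓝 p₀, ∀ u, mvnDensity 0 (P p) (u + b p) =
      Real.exp (∑ s, naturalParam (P p) (b p) s * monomial₂ s u) := by
    filter_upwards [hpos] with p hp u using mvnDensity_add_eq_exp_sum hp.det_pos u (b p)
  have hd : ∀ u, HasFDerivAt (fun p => mvnDensity 0 (P p) (u + b p))
      (Real.exp (∑ s, naturalParam (P p₀) (b p₀) s * monomial₂ s u) •
        ∑ s, monomial₂ s u • fderiv ℝ (fun p => naturalParam (P p) (b p) s) p₀) p₀ := by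
    intro u
    refine HasFDerivAt.congr_of_eventuallyEq ?_ (heq.mono fun p hp => hp u)
    refine HasFDerivAt.exp (HasFDerivAt.fun_sum fun α _ => ?_)
    exact ((ha α).differentiableAt (by simp)).hasFDerivAt.mul_const _
  -- The extra `1` here, in `R` and in `N p₀ + 1` makes the bounds strict at `p₀`, so by continuity
  -- they persist nearby.
  set K : ℝ := ∑ i, ∑ j, (|P p₀ i j| + 1) with hK
  have hK0 : 0 ≤ K := by positivity
  set R : ℝ := ∑ i, b p₀ i ^ 2 + 1 with hR
  have hKle : ∀ i j, |P p₀ i j| + 1 ≤ K := fun i j =>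
    (Finset.single_le_sum (f := fun j => |P p₀ i j| + 1) (fun _ _ => by positivity)
      (Finset.mem_univ j)).trans (Finset.single_le_sum (f := fun i => ∑ j, (|P p₀ i j| + 1))
        (fun _ _ => by positivity) (Finset.mem_univ i))
  have hev1 : ∀ᶠ p in 𝓝 p₀, ∀ i j, |P p i j| ≤ K :=
    eventually_all.2 fun i => eventually_all.2 fun j =>
      ((hP i j).continuousAt.abs.eventually_lt_const
        (lt_of_lt_of_le (lt_add_one _) (hKle i j))).mono fun _ h => h.le
  have hev2 : ∀ᶠ p in 𝓝 p₀, ∑ i, b p i ^ 2 ≤ R := by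
    have h1 : ContinuousAt (fun p => ∑ i, b p i ^ 2) p₀ :=
      tendsto_finsetSum _ fun i _ => (hb i).continuousAt.pow 2
    exact (h1.eventually_lt_const (lt_add_one _)).mono fun _ h => h.le
  set N : E → ℝ := fun p => Real.exp (R / (2 * (K * Fintype.card ι + 1))) /
    (Real.sqrt (2 * Real.pi) ^ Fintype.card ι * Real.sqrt (P p).det) with hN
  have hev3 : ∀ᶠ p in 𝓝 p₀, N p ≤ N p₀ + 1 := by
    have h1 : ContinuousAt N p₀ := by
      refine ContinuousAt.div continuousAt_const
        (continuousAt_const.mul (contDiffAt_det hP).continuousAt.sqrt) ?_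
      have := Real.sqrt_pos.2 hdet₀
      positivity
    exact (h1.eventually_lt_const (lt_add_one _)).mono fun _ h => h.le
  set ε : ℝ := 1 / (4 * (K * Fintype.card ι + 1)) with hε
  have hε0 : 0 < ε := by positivity
  obtain ⟨h1, h2⟩ := hasFDerivAt_integral_exp_sum (μ := volume.restrict s) (p₀ := p₀)
    (a := fun s p => naturalParam (P p) (b p) s) (m := monomial₂)
    (w := fun u => 1 + ∑ i, u i ^ 2)
    (B := fun u => (N p₀ + 1) * Real.exp (-ε * ∑ i, u i ^ 2)) ha measurable_monomial₂
    abs_monomial₂_le (by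
      filter_upwards [hpos, heq, hev1, hev2, hev3] with p h1 h2 h3 h4 h5 u
      rw [← h2 u]
      refine (mvnDensity_add_le h1 hK0 h3 h4 u).trans ?_
      exact mul_le_mul_of_nonneg_right h5 (Real.exp_pos _).le)
    ((integrable_exp_neg_sum_sq hε0).const_mul _).restrict
    (by
      refine Integrable.restrict ?_
      refine ((integrable_one_add_mul_exp_neg_sum_sq (ι := ι) hε0).const_mul (N p₀ + 1)).congr
        (ae_of_all _ fun u => ?_)
      ring)
  simp only [fun u => (hd u).fderiv]
  refine ⟨fun u => (hd u).differentiableAt, h1, h2.congr_of_eventuallyEq ?_⟩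
  filter_upwards [heq] with p hp
  simp only [hp]

end Smooth

/-! ### Derivatives of the normal density in its argument and its covariance -/

section DensityDerivatives

variable {ι : Type} [Fintype ι]

theorem hasDerivAt_mulVec_apply {w : ℝ → ι → ℝ} {v : ι → ℝ} {s : ℝ}
    (hw : ∀ i, HasDerivAt (fun x => w x i) (v i) s) (Q : Matrix ι ι ℝ) (i : ι) :
    HasDerivAt (fun x => Q.mulVec (w x) i) (Q.mulVec v i) s :=
  HasDerivAt.fun_sum fun j _ => (hw j).const_mul _

theorem hasDerivAt_dotProduct_mulVec {w : ℝ → ι → ℝ} {v : ι → ℝ} {s : ℝ}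
    (hw : ∀ i, HasDerivAt (fun x => w x i) (v i) s) (Q : Matrix ι ι ℝ) (u : ι → ℝ) :
    HasDerivAt (fun x => u ⬝ᵥ Q.mulVec (w x)) (u ⬝ᵥ Q.mulVec v) s :=
  HasDerivAt.fun_sum fun j _ => (hasDerivAt_mulVec_apply hw Q j).const_mul _

theorem hasDerivAt_quadForm {w : ℝ → ι → ℝ} {v : ι → ℝ} {s : ℝ}
    (hw : ∀ i, HasDerivAt (fun x => w x i) (v i) s) {Q : Matrix ι ι ℝ} (hQ : Q.transpose = Q) :
    HasDerivAt (fun x => w x ⬝ᵥ Q.mulVec (w x)) (2 * (v ⬝ᵥ Q.mulVec (w s))) s := by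
  have h1 : HasDerivAt (fun x => w x ⬝ᵥ Q.mulVec (w x))
      (∑ i, (v i * Q.mulVec (w s) i + w s i * Q.mulVec v i)) s :=
    HasDerivAt.fun_sum fun i _ => (hw i).mul (hasDerivAt_mulVec_apply hw Q i)
  convert h1 using 1
  have h2 : w s ⬝ᵥ Q.mulVec v = v ⬝ᵥ Q.mulVec (w s) := by
    rw [Matrix.dotProduct_mulVec, ← Matrix.mulVec_transpose, hQ, dotProduct_comm]
  rw [Finset.sum_add_distrib]
  change _ = v ⬝ᵥ Q.mulVec (w s) + w s ⬝ᵥ Q.mulVec v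
  rw [h2]
  ring

theorem exists_abs_mulVec_le (Q : Matrix ι ι ℝ) :
    ∃ K : ℝ, 0 ≤ K ∧ ∀ (v : ι) (z : ι → ℝ), (Q.mulVec z v) ^ 2 ≤ K * ∑ i, z i ^ 2 := by
  refine ⟨∑ v, ∑ j, Q v j ^ 2, by positivity, fun v z => ?_⟩
  refine (Finset.sum_mul_sq_le_sq_mul_sq Finset.univ (fun j => Q v j) z).trans ?_
  refine mul_le_mul_of_nonneg_right ?_ (Finset.sum_nonneg fun _ _ => sq_nonneg _)
  exact Finset.single_le_sum (f := fun v => ∑ j, Q v j ^ 2) (fun _ _ => by positivity)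
    (Finset.mem_univ v)

variable [DecidableEq ι]

theorem transpose_inv_eq_of_posDef {P : Matrix ι ι ℝ} (hP : P.PosDef) :
    (P⁻¹).transpose = P⁻¹ := by simpa using hP.inv.isHermitian.eq

theorem hasDerivAt_mvnDensity_comp {w : ℝ → ι → ℝ} {v : ι → ℝ} {s : ℝ}
    (hw : ∀ i, HasDerivAt (fun x => w x i) (v i) s) {P : Matrix ι ι ℝ} (hP : P.PosDef) :
    HasDerivAt (fun x => mvnDensity 0 P (w x))
      (-(v ⬝ᵥ (P⁻¹).mulVec (w s)) * mvnDensity 0 P (w s)) s := by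
  simp only [mvnDensity, sub_zero]
  have h1 := (((hasDerivAt_quadForm hw (transpose_inv_eq_of_posDef hP)).neg.div_const 2).exp).div_const
    (Real.sqrt (2 * Real.pi) ^ Fintype.card ι * Real.sqrt P.det)
  refine h1.congr_deriv ?_
  simp only [Pi.neg_apply]
  ring

/-- The function differentiated here is the derivative of the density along `v'`, so the result is
the mixed second derivative along `v'` and `v`. -/
theorem hasDerivAt_linear_mul_mvnDensity_comp {w : ℝ → ι → ℝ} {v : ι → ℝ} {s : ℝ}
    (hw : ∀ i, HasDerivAt (fun x => w x i) (v i) s) {P : Matrix ι ι ℝ} (hP : P.PosDef)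
    (v' : ι → ℝ) :
    HasDerivAt (fun x => -(v' ⬝ᵥ (P⁻¹).mulVec (w x)) * mvnDensity 0 P (w x))
      (((v ⬝ᵥ (P⁻¹).mulVec (w s)) * (v' ⬝ᵥ (P⁻¹).mulVec (w s)) - v' ⬝ᵥ (P⁻¹).mulVec v) *
        mvnDensity 0 P (w s)) s := by
  have h1 := (hasDerivAt_dotProduct_mulVec hw P⁻¹ v').neg.mul (hasDerivAt_mvnDensity_comp hw hP)
  refine h1.congr_deriv ?_
  simp only [Pi.neg_apply]
  ring

/-- Jacobi's formula, from $\det(P+sA)=\det P\,\det(1+sP^{-1}A)$ and the first-order expansion of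
the second factor. -/
theorem hasDerivAt_det_add_smul {P : Matrix ι ι ℝ} (hP : IsUnit P.det) (A : Matrix ι ι ℝ) :
    HasDerivAt (fun s : ℝ => (P + s • A).det) (P.det * (P⁻¹ * A).trace) 0 := by
  have h1 : ∀ s : ℝ, (P + s • A).det = P.det * (1 + s • (P⁻¹ * A)).det := by
    intro s
    rw [← Matrix.det_mul, Matrix.mul_add, Matrix.mul_one, Matrix.mul_smul,
      Matrix.mul_nonsing_inv_cancel_left _ _ hP]
  simp only [h1]
  simp_rw [fun s : ℝ => Matrix.det_one_add_smul s (P⁻¹ * A)]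
  -- The polynomial `p` collects the terms of order at least two; it is multiplied by `s ^ 2` and
  -- contributes nothing at `0`.
  set p := (Matrix.det (1 + (Polynomial.X : Polynomial ℝ) • (P⁻¹ * A).map Polynomial.C)).divX.divX
  have h2 : HasDerivAt (fun s : ℝ => P.det * (1 + (P⁻¹ * A).trace * s + p.eval s * s ^ 2))
      (P.det * ((P⁻¹ * A).trace * 1 + ((p.derivative.eval 0) * 0 ^ 2 +
        p.eval 0 * (↑(2 : ℕ) * 0 ^ (2 - 1) * 1)))) 0 :=
    ((((hasDerivAt_id (0 : ℝ)).const_mul _).const_add 1).add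
      ((p.hasDerivAt 0).mul ((hasDerivAt_id (0 : ℝ)).pow 2))).const_mul _
  exact h2.congr_deriv (by simp)

/-- The resolvent identity $(P+sA)^{-1}=P^{-1}-s(P+sA)^{-1}AP^{-1}$ exhibits a factor $s$, so the
derivative at $0$ is read off by evaluating the remaining factor there. -/
theorem hasDerivAt_inv_quadForm_add_smul {P : Matrix ι ι ℝ} (hP : P.PosDef) (A : Matrix ι ι ℝ)
    (z : ι → ℝ) :
    HasDerivAt (fun s : ℝ => z ⬝ᵥ ((P + s • A)⁻¹).mulVec z)
      (-((P⁻¹).mulVec z ⬝ᵥ A.mulVec ((P⁻¹).mulVec z))) 0 := by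
  have hu : IsUnit P.det := hP.det_pos.ne'.isUnit
  have hc : ContinuousAt (fun s : ℝ => (P + s • A).det) 0 :=
    (hasDerivAt_det_add_smul hu A).continuousAt
  have hne : ∀ᶠ s : ℝ in 𝓝 0, (P + s • A).det ≠ 0 := hc.eventually_ne (by simpa using hu.ne_zero)
  set u := A.mulVec ((P⁻¹).mulVec z) with hu'
  have h1 : ∀ s : ℝ, (P + s • A).det ≠ 0 → z ⬝ᵥ ((P + s • A)⁻¹).mulVec z =
      z ⬝ᵥ (P⁻¹).mulVec z - s * (z ⬝ᵥ ((P + s • A)⁻¹).mulVec u) := by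
    intro s hs
    have h2 : ((P + s • A)⁻¹).mulVec ((P + s • A).mulVec ((P⁻¹).mulVec z)) = (P⁻¹).mulVec z := by
      rw [Matrix.mulVec_mulVec, Matrix.nonsing_inv_mul _ hs.isUnit, Matrix.one_mulVec]
    have h3 : (P + s • A).mulVec ((P⁻¹).mulVec z) = z + s • u := by
      rw [Matrix.add_mulVec, Matrix.mulVec_mulVec, Matrix.mul_nonsing_inv _ hu,
        Matrix.one_mulVec, Matrix.smul_mulVec, hu']
    rw [h3, Matrix.mulVec_add, Matrix.mulVec_smul] at h2
    rw [← h2, dotProduct_add, dotProduct_smul, smul_eq_mul]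
    ring
  have h4 : DifferentiableAt ℝ (fun s : ℝ => z ⬝ᵥ ((P + s • A)⁻¹).mulVec u) 0 := by
    have h5 := contDiffAt_matrix_inv_apply (A := fun s : ℝ => P + s • A) (p₀ := 0)
      (fun i j => by simp only [Matrix.add_apply, Matrix.smul_apply]; fun_prop)
      (by simpa using hu.ne_zero)
    simp only [dotProduct, Matrix.mulVec]
    refine DifferentiableAt.fun_sum fun i _ => (DifferentiableAt.fun_sum fun j _ => ?_).const_mul _
    exact ((h5 i j).differentiableAt (by simp)).mul_const _
  have h6 : HasDerivAt (fun s : ℝ => z ⬝ᵥ (P⁻¹).mulVec z -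
      s * (z ⬝ᵥ ((P + s • A)⁻¹).mulVec u)) (-(z ⬝ᵥ (P⁻¹).mulVec u)) 0 := by
    have h7 := ((hasDerivAt_id (0 : ℝ)).mul h4.hasDerivAt).const_sub (z ⬝ᵥ (P⁻¹).mulVec z)
    exact h7.congr_deriv (by simp)
  have h8 : z ⬝ᵥ (P⁻¹).mulVec u = (P⁻¹).mulVec z ⬝ᵥ u := by
    rw [Matrix.dotProduct_mulVec, ← Matrix.mulVec_transpose, transpose_inv_eq_of_posDef hP]
  rw [h8] at h6
  exact h6.congr_of_eventuallyEq (hne.mono fun s hs => h1 s hs)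

theorem hasDerivAt_mvnDensity_add_smul {P : Matrix ι ι ℝ} (hP : P.PosDef) (A : Matrix ι ι ℝ)
    (z : ι → ℝ) :
    HasDerivAt (fun s : ℝ => mvnDensity 0 (P + s • A) z)
      (((P⁻¹).mulVec z ⬝ᵥ A.mulVec ((P⁻¹).mulVec z) - (P⁻¹ * A).trace) / 2 *
        mvnDensity 0 P z) 0 := by
  have hu : IsUnit P.det := hP.det_pos.ne'.isUnit
  have hd := hasDerivAt_det_add_smul hu A
  have hpos : ∀ᶠ s : ℝ in 𝓝 0, 0 < (P + s • A).det :=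
    hd.continuousAt.eventually_const_lt (by simpa using hP.det_pos)
  have h1 : HasDerivAt (fun s : ℝ => Real.exp (-(z ⬝ᵥ ((P + s • A)⁻¹).mulVec z) / 2 -
      (Fintype.card ι * Real.log (Real.sqrt (2 * Real.pi)) + Real.log (P + s • A).det / 2))) _ 0 :=
    (((hasDerivAt_inv_quadForm_add_smul hP A z).neg.div_const 2).sub
      (((hd.log (by simpa using hu.ne_zero)).div_const 2).const_add _)).exp
  refine (h1.congr_of_eventuallyEq (hpos.mono fun s hs => mvnDensity_zero_eq_exp hs z)).congr_deriv ?_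
  have h2 : P.det ≠ 0 := hu.ne_zero
  rw [mvnDensity_zero_eq_exp hP.det_pos]
  simp only [zero_smul, add_zero, Pi.neg_apply, Pi.sub_apply]
  rw [mul_div_cancel_left₀ _ h2]
  simp
  ring

/-- The heat-type identity between covariance derivatives and mixed second derivatives. -/
theorem hasDerivAt_mvnDensity_add_smul_single {P : Matrix ι ι ℝ} (hP : P.PosDef) (i j : ι)
    (z : ι → ℝ) :
    HasDerivAt (fun s : ℝ => mvnDensity 0
        (P + s • (Matrix.single i j 1 + Matrix.single j i 1)) z)
      (((P⁻¹).mulVec z i * (P⁻¹).mulVec z j - P⁻¹ j i) * mvnDensity 0 P z) 0 := by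
  refine (hasDerivAt_mvnDensity_add_smul hP _ z).congr_deriv ?_
  have hs : P⁻¹ i j = P⁻¹ j i := by
    conv_lhs => rw [← transpose_inv_eq_of_posDef hP]
    rfl
  have h1 : (P⁻¹ * (Matrix.single i j 1 + Matrix.single j i 1)).trace = 2 * P⁻¹ j i := by
    rw [Matrix.mul_add, Matrix.trace_add, Matrix.trace_mul_single, Matrix.trace_mul_single, hs]
    simp [two_mul]
  rw [h1, Matrix.add_mulVec, dotProduct_add]
  simp only [Matrix.single_mulVec, one_mul]
  simp only [dotProduct, Function.update_apply, Pi.zero_apply, mul_ite, mul_zero,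
    Finset.sum_ite_eq', Finset.mem_univ, if_true]
  ring

/-- One Gaussian majorant serves the density and its first and second partial derivatives. It gives
integrability and makes the boundary terms at $-\infty$ vanish. -/
theorem exists_derivatives_mvnDensity_le {P : Matrix ι ι ℝ} (hP : P.PosDef) :
    ∃ C c : ℝ, 0 < C ∧ 0 < c ∧ ∀ z, mvnDensity 0 P z ≤ C * Real.exp (-c * ∑ i, z i ^ 2) ∧
      (∀ k, |-(P⁻¹).mulVec z k * mvnDensity 0 P z| ≤ C * Real.exp (-c * ∑ i, z i ^ 2)) ∧
      ∀ i j, |((P⁻¹).mulVec z i * (P⁻¹).mulVec z j - P⁻¹ j i) * mvnDensity 0 P z| ≤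
        C * Real.exp (-c * ∑ i, z i ^ 2) := by
  obtain ⟨C, c, hC, hc, h⟩ := exists_mvnDensity_le hP
  obtain ⟨K, hK, hKle⟩ := exists_abs_mulVec_le P⁻¹
  set N : ℝ := ∑ j, ∑ i, |P⁻¹ j i| with hN
  have hN0 : 0 ≤ N := by positivity
  have hNle : ∀ i j, |P⁻¹ j i| ≤ N := fun i j =>
    (Finset.single_le_sum (f := fun i => |P⁻¹ j i|) (fun _ _ => abs_nonneg _)
      (Finset.mem_univ i)).trans (Finset.single_le_sum (f := fun j => ∑ i, |P⁻¹ j i|)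
        (fun _ _ => by positivity) (Finset.mem_univ j))
  -- All three bounds concern the density times a factor of at most quadratic growth; the density
  -- itself is the case `a = 1`. The growth is paid for by halving `c`.
  have key : ∀ z a, |a| ≤ (1 + N + K) * (1 + ∑ i, z i ^ 2) →
      |a * mvnDensity 0 P z| ≤
        ((1 + N + K) * C * (1 + 2 / c)) * Real.exp (-(c / 2) * ∑ i, z i ^ 2) := by
    intro z a ha
    have h0 : 0 ≤ ∑ i, z i ^ 2 := Finset.sum_nonneg fun _ _ => sq_nonneg _
    rw [abs_mul, abs_of_pos (mvnDensity_pos hP.det_pos _ _)]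
    calc |a| * mvnDensity 0 P z ≤ ((1 + N + K) * (1 + ∑ i, z i ^ 2)) *
          (C * Real.exp (-c * ∑ i, z i ^ 2)) :=
          mul_le_mul ha (h z) (mvnDensity_pos hP.det_pos _ _).le (by positivity)
      _ = ((1 + N + K) * C) * ((1 + ∑ i, z i ^ 2) * Real.exp (-c * ∑ i, z i ^ 2)) := by ring
      _ ≤ ((1 + N + K) * C) * ((1 + 2 / c) * Real.exp (-(c / 2) * ∑ i, z i ^ 2)) := by
          exact mul_le_mul_of_nonneg_left (one_add_mul_exp_le hc h0) (by positivity)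
      _ = _ := by ring
  refine ⟨(1 + N + K) * C * (1 + 2 / c), c / 2, by positivity, by positivity,
    fun z => ⟨?_, fun k => key z _ ?_, fun i j => key z _ ?_⟩⟩
  all_goals have h0 : 0 ≤ ∑ i, z i ^ 2 := Finset.sum_nonneg fun _ _ => sq_nonneg _
  all_goals have hKs : 0 ≤ K * ∑ i, z i ^ 2 := by positivity
  all_goals have hNs : 0 ≤ N * ∑ i, z i ^ 2 := by positivity
  · have h1 := key z 1 (by rw [abs_one]; nlinarith)
    rw [one_mul] at h1
    exact (le_abs_self _).trans h1
  · rw [abs_neg]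
    have h1 := hKle k z
    nlinarith [sq_nonneg (|(P⁻¹).mulVec z k| - 1), sq_abs ((P⁻¹).mulVec z k)]
  · have h1 := hKle i z
    have h2 := hKle j z
    have h3 := hNle i j
    have h4 := abs_sub ((P⁻¹).mulVec z i * (P⁻¹).mulVec z j) (P⁻¹ j i)
    rw [abs_mul] at h4
    nlinarith [sq_nonneg (|(P⁻¹).mulVec z i| - |(P⁻¹).mulVec z j|), sq_abs ((P⁻¹).mulVec z i),
      sq_abs ((P⁻¹).mulVec z j)]

end DensityDerivatives

/-! ### Fubini over coordinate blocks and the marginal-conditional factorization -/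

theorem sum_sq_sumElim {κ σ ι : Type} [Fintype κ] [Fintype σ] [Fintype ι] (e : κ ⊕ σ ≃ ι) (x : κ → ℝ) (w : σ → ℝ) :
    ∑ i, (Sum.elim x w ∘ e.symm) i ^ 2 = ∑ a, x a ^ 2 + ∑ m, w m ^ 2 := by
  rw [← Equiv.sum_comp e, Fintype.sum_sum_type]
  simp

/-- Fubini along the splitting `e`. The block `κ` is innermost because it holds the coordinates in
which the integrand will be a derivative. -/
theorem setIntegral_Iic_sumEquiv {κ σ ι : Type} [Fintype κ] [Fintype σ] [Fintype ι]
    (e : κ ⊕ σ ≃ ι) (b : ι → ℝ) {g : (ι → ℝ) → ℝ}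
    (hg : Integrable g) :
    ∫ z in Set.Iic b, g z = ∫ w in Set.Iic (b ∘ e ∘ Sum.inr), ∫ x in Set.Iic (b ∘ e ∘ Sum.inl),
      g (Sum.elim x w ∘ e.symm) := by
  let Φ : (κ → ℝ) × (σ → ℝ) ≃ᵐ (ι → ℝ) :=
    (MeasurableEquiv.sumPiEquivProdPi (fun _ : κ ⊕ σ => ℝ)).symm.trans
      (MeasurableEquiv.piCongrLeft (fun _ : ι => ℝ) e)
  have hΦ : MeasurePreserving Φ volume volume :=
    (volume_measurePreserving_sumPiEquivProdPi_symm (fun _ : κ ⊕ σ => ℝ)).trans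
      (volume_measurePreserving_piCongrLeft (fun _ : ι => ℝ) e)
  have hΦa : ∀ p, Φ p = Sum.elim p.1 p.2 ∘ e.symm := by
    intro p
    funext i
    obtain ⟨s, rfl⟩ := e.surjective i
    have h1 : Φ p (e s) = (MeasurableEquiv.sumPiEquivProdPi (fun _ : κ ⊕ σ => ℝ)).symm p s :=
      MeasurableEquiv.piCongrLeft_apply_apply (β := fun _ : ι => ℝ) e _ s
    rw [h1]
    cases s <;> simp [MeasurableEquiv.coe_sumPiEquivProdPi_symm]
  have hpre : Φ ⁻¹' Set.Iic b = Set.Iic (b ∘ e ∘ Sum.inl) ×ˢ Set.Iic (b ∘ e ∘ Sum.inr) := by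
    ext p
    simp only [Set.mem_preimage, Set.mem_Iic, hΦa, Set.mem_prod, Pi.le_def, Function.comp_apply]
    constructor
    · intro h
      exact ⟨fun a => by simpa using h (e (Sum.inl a)), fun a => by simpa using h (e (Sum.inr a))⟩
    · rintro ⟨h1, h2⟩ i
      obtain ⟨s, rfl⟩ := e.surjective i
      cases s <;> simp [h1, h2]
  rw [← hΦ.setIntegral_preimage_emb Φ.measurableEmbedding, hpre, Measure.volume_eq_prod,
    ← Measure.prod_restrict, integral_prod_symm]
  · simp only [hΦa]
  · rw [Measure.prod_restrict]
    exact ((hΦ.integrable_comp_emb Φ.measurableEmbedding).2 hg).restrict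

section Blocks

variable {κ σ ι : Type} [Fintype κ] [Fintype σ] [Fintype ι] [DecidableEq κ] [DecidableEq σ]
  [DecidableEq ι]

/-- Factorization of a centred normal density into a marginal and a conditional density. -/
theorem mvnDensity_fromBlocks {A : Matrix κ κ ℝ} {B : Matrix σ κ ℝ} {D : Matrix σ σ ℝ}
    (hM : (Matrix.fromBlocks A B.transpose B D).PosDef) (x : κ → ℝ) (w : σ → ℝ) :
    mvnDensity 0 (Matrix.fromBlocks A B.transpose B D) (Sum.elim x w) =
      mvnDensity 0 A x *
        mvnDensity ((B * A⁻¹).mulVec x) (D - B * A⁻¹ * B.transpose) w := by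
  have hA : A.PosDef := by
    have := hM.submatrix (e := (Sum.inl : κ → κ ⊕ σ)) Sum.inl_injective
    exact this
  have hAu : IsUnit A.det := hA.det_pos.ne'.isUnit
  have hMu := hM.det_pos.ne'.isUnit
  set S := D - B * A⁻¹ * B.transpose with hS
  have hdet : (Matrix.fromBlocks A B.transpose B D).det = A.det * S.det := by
    let := A.invertibleOfIsUnitDet hAu
    rw [Matrix.det_fromBlocks₁₁, Matrix.invOf_eq_nonsing_inv]
  have hSpos : 0 < S.det := by
    have := hM.det_pos
    rw [hdet] at this
    exact pos_of_mul_pos_right this hA.det_pos.le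
  have hSu : IsUnit S.det := hSpos.ne'.isUnit
  set m := (B * A⁻¹).mulVec x with hm
  -- The pair `(v₁, v₂)` solves the block system with right side `(x, w)` by elimination with the
  -- Schur complement `S`, which avoids a block formula for the inverse.
  set v₂ := (S⁻¹).mulVec (w - m) with hv₂
  set v₁ := (A⁻¹).mulVec x - (A⁻¹).mulVec (B.transpose.mulVec v₂) with hv₁
  have hSv : S.mulVec v₂ = w - m := by
    rw [hv₂, Matrix.mulVec_mulVec, Matrix.mul_nonsing_inv _ hSu, Matrix.one_mulVec]
  have hMv : (Matrix.fromBlocks A B.transpose B D).mulVec (Sum.elim v₁ v₂) = Sum.elim x w := by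
    rw [Matrix.fromBlocks_mulVec]
    have h1 : A.mulVec v₁ + B.transpose.mulVec v₂ = x := by
      rw [hv₁, Matrix.mulVec_sub, Matrix.mulVec_mulVec, Matrix.mulVec_mulVec,
        Matrix.mul_nonsing_inv _ hAu, Matrix.one_mulVec, Matrix.one_mulVec, sub_add_cancel]
    have h2 : B.mulVec v₁ + D.mulVec v₂ = w := by
      have h3 : D = S + B * A⁻¹ * B.transpose := by rw [hS, sub_add_cancel]
      rw [h3, Matrix.add_mulVec, hSv, hv₁, Matrix.mulVec_sub, Matrix.mulVec_mulVec,
        Matrix.mulVec_mulVec, Matrix.mulVec_mulVec, ← hm, Matrix.mul_assoc]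
      abel
    simp only [Sum.elim_comp_inl, Sum.elim_comp_inr, h1, h2]
  have hinv : ((Matrix.fromBlocks A B.transpose B D)⁻¹).mulVec (Sum.elim x w) =
      Sum.elim v₁ v₂ := by
    rw [← hMv, Matrix.mulVec_mulVec, Matrix.nonsing_inv_mul _ hMu, Matrix.one_mulVec]
  have hquad : Sum.elim x w ⬝ᵥ Sum.elim v₁ v₂ =
      x ⬝ᵥ (A⁻¹).mulVec x + (w - m) ⬝ᵥ (S⁻¹).mulVec (w - m) := by
    have h4 : x ⬝ᵥ (A⁻¹).mulVec (B.transpose.mulVec v₂) = m ⬝ᵥ v₂ := by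
      rw [Matrix.dotProduct_mulVec, ← Matrix.mulVec_transpose, transpose_inv_eq_of_posDef hA,
        Matrix.dotProduct_mulVec, Matrix.vecMul_transpose, Matrix.mulVec_mulVec]
    have h5 : Sum.elim x w ⬝ᵥ Sum.elim v₁ v₂ = x ⬝ᵥ v₁ + w ⬝ᵥ v₂ := by
      simp [dotProduct]
    rw [h5, hv₁, dotProduct_sub, h4, sub_dotProduct]
    ring
  simp only [mvnDensity, sub_zero]
  rw [hinv, hquad, hdet, Real.sqrt_mul hA.det_pos.le, Fintype.card_sum, pow_add, neg_add, add_div,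
    Real.exp_add]
  have h6 := Real.sqrt_pos.2 hA.det_pos
  have h7 := Real.sqrt_pos.2 hSpos
  have h8 : 0 < Real.sqrt (2 * Real.pi) := by positivity
  field_simp

theorem mvnDensity_submatrix_equiv (e : κ ≃ ι) (P : Matrix ι ι ℝ) (z : ι → ℝ) :
    mvnDensity 0 (P.submatrix e e) (z ∘ e) = mvnDensity 0 P z := by
  simp only [mvnDensity, sub_zero, Matrix.inv_submatrix_equiv, Matrix.det_submatrix_equiv_self,
    Fintype.card_congr e, Matrix.submatrix_mulVec_equiv]
  congr 4
  rw [Function.comp_assoc, Equiv.self_comp_symm, Function.comp_id]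
  exact Equiv.sum_comp e (fun i => z i * (P⁻¹).mulVec z i)

/-- The conditional mean of the block `r` given the block `f`. -/
noncomputable def blockMean (P : Matrix ι ι ℝ) (f : κ → ι) (r : σ → ι) (x : κ → ℝ) : σ → ℝ :=
  (P.submatrix r f * (P.submatrix f f)⁻¹).mulVec x

/-- The conditional covariance of the block `r` given the block `f`. -/
noncomputable def blockCov (P : Matrix ι ι ℝ) (f : κ → ι) (r : σ → ι) : Matrix σ σ ℝ :=
  P.submatrix r r - P.submatrix r f * (P.submatrix f f)⁻¹ * (P.submatrix r f).transpose

theorem mvnDensity_sumElim (e : κ ⊕ σ ≃ ι) {P : Matrix ι ι ℝ} (hP : P.PosDef) (x : κ → ℝ)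
    (w : σ → ℝ) :
    mvnDensity 0 P (Sum.elim x w ∘ e.symm) =
      mvnDensity 0 (P.submatrix (e ∘ Sum.inl) (e ∘ Sum.inl)) x *
        mvnDensity (blockMean P (e ∘ Sum.inl) (e ∘ Sum.inr) x)
          (blockCov P (e ∘ Sum.inl) (e ∘ Sum.inr)) w := by
  have hs : ∀ i j, P i j = P j i := fun i j => by
    have : P.transpose = P := by simpa using hP.isHermitian.eq
    conv_lhs => rw [← this]
    rfl
  have h1 : P.submatrix e e = Matrix.fromBlocks (P.submatrix (e ∘ Sum.inl) (e ∘ Sum.inl))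
      (P.submatrix (e ∘ Sum.inr) (e ∘ Sum.inl)).transpose
      (P.submatrix (e ∘ Sum.inr) (e ∘ Sum.inl)) (P.submatrix (e ∘ Sum.inr) (e ∘ Sum.inr)) := by
    ext (a | a) (b | b) <;> simp [hs]
  rw [← mvnDensity_submatrix_equiv e, Function.comp_assoc, Equiv.symm_comp_self,
    Function.comp_id, h1, mvnDensity_fromBlocks, blockMean, blockCov]
  rw [← h1]
  exact hP.submatrix e.injective

theorem setIntegral_Iic_unit (β : Unit → ℝ) (G : (Unit → ℝ) → ℝ) :
    ∫ x in Set.Iic β, G x = ∫ t in Set.Iic (β ()), G fun _ => t := by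
  have h := (volume_preserving_funUnique Unit ℝ).symm
  rw [← h.setIntegral_preimage_emb (MeasurableEquiv.measurableEmbedding _)]
  congr 1
  congr 1
  ext t
  exact ⟨fun h => h (), fun h _ => h⟩

theorem setIntegral_Iic_fin_two (β : Fin 2 → ℝ) {G : (Fin 2 → ℝ) → ℝ} (hG : Integrable G) :
    ∫ x in Set.Iic β, G x = ∫ t in Set.Iic (β 0), ∫ s in Set.Iic (β 1), G ![t, s] := by
  have h := (volume_preserving_finTwoArrow ℝ).symm
  rw [← h.setIntegral_preimage_emb (MeasurableEquiv.measurableEmbedding _)]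
  have hpre : (MeasurableEquiv.finTwoArrow.symm : ℝ × ℝ → Fin 2 → ℝ) ⁻¹' Set.Iic β =
      Set.Iic (β 0) ×ˢ Set.Iic (β 1) := by
    ext p
    simp [Pi.le_def, Fin.forall_fin_two, Prod.le_def]
  rw [hpre, Measure.volume_eq_prod, setIntegral_prod]
  · rfl
  · exact ((h.integrable_comp_emb (MeasurableEquiv.measurableEmbedding _)).2 hG).integrableOn

end Blocks

/-! ### Integrating density derivatives over half-lines and orthants -/

section HalfLine

theorem tendsto_const_mul_exp_neg_mul_sq_atBot (C : ℝ) {c : ℝ} (hc : 0 < c) :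
    Tendsto (fun x : ℝ => C * Real.exp (-c * x ^ 2)) atBot (𝓝 0) := by
  rw [← mul_zero C]
  refine Tendsto.const_mul C (Real.tendsto_exp_atBot.comp ?_)
  have h1 : Tendsto (fun x : ℝ => x ^ 2) atBot atTop := by
    simpa [sq] using tendsto_id.atBot_mul_atBot₀ (tendsto_id (α := ℝ))
  exact h1.const_mul_atTop_of_neg (by linarith)

/-- The fundamental theorem of calculus: the bound on `F'` gives integrability, the bound on `F`
kills the boundary term at $-\infty$. -/
theorem setIntegral_Iic_deriv_of_gaussian_tails {F F' : ℝ → ℝ} {C c : ℝ} (hc : 0 < c)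
    (hF : ∀ x, HasDerivAt F (F' x) x) (hF' : Continuous F')
    (hb : ∀ x, |F x| ≤ C * Real.exp (-c * x ^ 2))
    (hb' : ∀ x, |F' x| ≤ C * Real.exp (-c * x ^ 2)) (a : ℝ) :
    ∫ x in Set.Iic a, F' x = F a := by
  rw [integral_Iic_of_hasDerivAt_of_tendsto' (f := F) (m := 0) (fun x _ => hF x), sub_zero]
  · exact (((integrable_exp_neg_mul_sq hc).const_mul C).mono' hF'.aestronglyMeasurable
      (ae_of_all _ hb')).integrableOn
  · exact squeeze_zero_norm hb (tendsto_const_mul_exp_neg_mul_sq_atBot C hc)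

end HalfLine

/-- An index type split into the range of an injection and the remaining indices. -/
noncomputable def splitEquiv {κ ι : Type} (f : κ → ι) (hf : f.Injective) (p : ι → Prop)
    (hp : ∀ m, p m ↔ ∀ a, f a ≠ m) : κ ⊕ {m // p m} ≃ ι :=
  Equiv.ofBijective (Sum.elim f Subtype.val) (by
    refine ⟨?_, fun m => ?_⟩
    · rintro (a | a) (b | b) h
      · rw [hf h]
      · exact absurd h ((hp _).1 b.2 a)
      · exact absurd h.symm ((hp _).1 a.2 b)
      · rw [Subtype.ext h]
    · by_cases h : ∀ a, f a ≠ m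
      · exact ⟨Sum.inr ⟨m, (hp m).2 h⟩, rfl⟩
      · push Not at h
        obtain ⟨a, ha⟩ := h
        exact ⟨Sum.inl a, ha⟩)

section Generic

variable {ι : Type} [Fintype ι] [DecidableEq ι]

theorem integrable_neg_mulVec_mul_mvnDensity {P : Matrix ι ι ℝ} (hP : P.PosDef) (k : ι) :
    Integrable fun z => -(P⁻¹).mulVec z k * mvnDensity 0 P z := by
  obtain ⟨C, c, -, hc, h⟩ := exists_derivatives_mvnDensity_le hP
  exact ((integrable_exp_neg_sum_sq hc).const_mul C).mono'
    (Continuous.aestronglyMeasurable (by fun_prop)) (ae_of_all _ fun z => (h z).2.1 k)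

theorem integrable_mulVec_mul_mulVec_mul_mvnDensity {P : Matrix ι ι ℝ} (hP : P.PosDef) (i j : ι) :
    Integrable fun z =>
      ((P⁻¹).mulVec z i * (P⁻¹).mulVec z j - P⁻¹ j i) * mvnDensity 0 P z := by
  obtain ⟨C, c, -, hc, h⟩ := exists_derivatives_mvnDensity_le hP
  exact ((integrable_exp_neg_sum_sq hc).const_mul C).mono'
    (Continuous.aestronglyMeasurable (by fun_prop)) (ae_of_all _ fun z => (h z).2.2 i j)

theorem mvnCdf_coe {κ : Type} [Fintype κ] [DecidableEq κ] (b : κ → ℝ) (μ : κ → ℝ)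
    (S : Matrix κ κ ℝ) :
    mvnCdf (fun j => (b j : EReal)) μ S = ∫ z in Set.Iic b, mvnDensity μ S z := by
  simp only [mvnCdf, EReal.coe_le_coe_iff]
  rfl

/-- On a slice the marginal factor is constant and only the conditional density is integrated. This
is the shape in which the scores are stated. -/
theorem setIntegral_Iic_mvnDensity_sumElim {κ σ : Type} [Fintype κ] [Fintype σ] [DecidableEq κ]
    [DecidableEq σ] (e : κ ⊕ σ ≃ ι) {P : Matrix ι ι ℝ} (hP : P.PosDef) (x : κ → ℝ) (b : σ → ℝ) :
    ∫ w in Set.Iic b, mvnDensity 0 P (Sum.elim x w ∘ e.symm) =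
      mvnDensity 0 (P.submatrix (e ∘ Sum.inl) (e ∘ Sum.inl)) x *
        mvnCdf (fun m => (b m : EReal)) (blockMean P (e ∘ Sum.inl) (e ∘ Sum.inr) x)
          (blockCov P (e ∘ Sum.inl) (e ∘ Sum.inr)) := by
  simp only [mvnDensity_sumElim e hP, integral_const_mul, mvnCdf_coe]

variable {P : Matrix ι ι ℝ}

/-- The integrand is the partial derivative of the density in the coordinate `e (Sum.inl ())`;
integrating that coordinate first leaves the boundary slice. -/
theorem setIntegral_Iic_partial_mvnDensity {σ : Type} [Fintype σ] [DecidableEq σ]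
    (e : Unit ⊕ σ ≃ ι) (hP : P.PosDef) (b : ι → ℝ) :
    ∫ z in Set.Iic b, -(P⁻¹).mulVec z (e (Sum.inl ())) * mvnDensity 0 P z =
      ∫ w in Set.Iic (b ∘ e ∘ Sum.inr),
        mvnDensity 0 P (Sum.elim (b ∘ e ∘ Sum.inl) w ∘ e.symm) := by
  obtain ⟨C, c, hC, hc, h⟩ := exists_derivatives_mvnDensity_le hP
  rw [setIntegral_Iic_sumEquiv e b (integrable_neg_mulVec_mul_mvnDensity hP _)]
  congr 1
  funext w
  rw [setIntegral_Iic_unit]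
  set z : ℝ → ι → ℝ := fun t => Sum.elim (fun _ => t) w ∘ e.symm with hz
  -- Dropping the squares of `w` gives a one-dimensional majorant in `t` with unchanged constants.
  have hle : ∀ t, C * Real.exp (-c * ∑ i, z t i ^ 2) ≤ C * Real.exp (-c * t ^ 2) := by
    intro t
    have h0 : 0 ≤ ∑ m, w m ^ 2 := Finset.sum_nonneg fun _ _ => sq_nonneg _
    rw [hz, sum_sq_sumElim e]
    refine mul_le_mul_of_nonneg_left (Real.exp_le_exp.2 ?_) hC.le
    simp only [Finset.univ_unique, Finset.sum_const, Finset.card_singleton, one_smul]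
    nlinarith [mul_nonneg hc.le h0]
  have hw : ∀ t i, HasDerivAt (fun s => z s i)
      ((Pi.single (e (Sum.inl ())) 1 : ι → ℝ) i) t := by
    intro t i
    obtain ⟨s, rfl⟩ := e.surjective i
    rcases s with _ | m
    · simpa [hz] using hasDerivAt_id' t
    · simpa [hz] using hasDerivAt_const t (w m)
  have hcont : Continuous z := continuous_pi fun i =>
    continuous_iff_continuousAt.2 fun t => (hw t i).continuousAt
  refine setIntegral_Iic_deriv_of_gaussian_tails (F := fun t => mvnDensity 0 P (z t))
    (F' := fun t => -(P⁻¹).mulVec (z t) (e (Sum.inl ())) * mvnDensity 0 P (z t))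
    (C := C) hc (fun t => ?_) (by fun_prop) (fun t => ?_) (fun t => ?_) _
  · exact (hasDerivAt_mvnDensity_comp (hw t) hP).congr_deriv (by simp only [single_one_dotProduct])
  · rw [abs_of_pos (mvnDensity_pos hP.det_pos _ _)]
    exact (h _).1.trans (hle t)
  · exact ((h _).2.1 _).trans (hle t)

/-- The integrand is a mixed second derivative. The inner integration, in the second coordinate,
returns the first derivative in the other one (`hinner`); the outer integration returns the density.
-/
theorem setIntegral_Iic_partial₂_mvnDensity {σ : Type} [Fintype σ] [DecidableEq σ]
    (e : Fin 2 ⊕ σ ≃ ι) (hP : P.PosDef) (b : ι → ℝ) :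
    ∫ z in Set.Iic b, ((P⁻¹).mulVec z (e (Sum.inl 0)) * (P⁻¹).mulVec z (e (Sum.inl 1)) -
        P⁻¹ (e (Sum.inl 1)) (e (Sum.inl 0))) * mvnDensity 0 P z =
      ∫ w in Set.Iic (b ∘ e ∘ Sum.inr),
        mvnDensity 0 P (Sum.elim (b ∘ e ∘ Sum.inl) w ∘ e.symm) := by
  obtain ⟨C, c, hC, hc, h⟩ := exists_derivatives_mvnDensity_le hP
  rw [setIntegral_Iic_sumEquiv e b (integrable_mulVec_mul_mulVec_mul_mvnDensity hP _ _)]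
  congr 1
  funext w
  set z : ℝ → ℝ → ι → ℝ := fun t s => Sum.elim ![t, s] w ∘ e.symm with hz
  have h0 : 0 ≤ ∑ m, w m ^ 2 := Finset.sum_nonneg fun _ _ => sq_nonneg _
  have hle : ∀ t s, C * Real.exp (-c * ∑ i, z t s i ^ 2) ≤ C * Real.exp (-c * t ^ 2) := by
    intro t s
    rw [hz, sum_sq_sumElim e]
    refine mul_le_mul_of_nonneg_left (Real.exp_le_exp.2 ?_) hC.le
    simp only [Fin.sum_univ_two, Matrix.cons_val_zero, Matrix.cons_val_one]
    nlinarith [mul_nonneg hc.le h0, mul_nonneg hc.le (sq_nonneg s)]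
  have hle' : ∀ t s, C * Real.exp (-c * ∑ i, z t s i ^ 2) ≤ C * Real.exp (-c * s ^ 2) := by
    intro t s
    rw [hz, sum_sq_sumElim e]
    refine mul_le_mul_of_nonneg_left (Real.exp_le_exp.2 ?_) hC.le
    simp only [Fin.sum_univ_two, Matrix.cons_val_zero, Matrix.cons_val_one]
    nlinarith [mul_nonneg hc.le h0, mul_nonneg hc.le (sq_nonneg t)]
  have hw0 : ∀ t s i, HasDerivAt (fun r => z r s i)
      ((Pi.single (e (Sum.inl 0)) 1 : ι → ℝ) i) t := by
    intro t s i
    obtain ⟨a, rfl⟩ := e.surjective i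
    rcases a with a | m
    · fin_cases a
      · simpa [hz] using hasDerivAt_id' t
      · simpa [hz, Pi.single_apply] using hasDerivAt_const t s
    · simpa [hz] using hasDerivAt_const t (w m)
  have hw1 : ∀ t s i, HasDerivAt (fun r => z t r i)
      ((Pi.single (e (Sum.inl 1)) 1 : ι → ℝ) i) s := by
    intro t s i
    obtain ⟨a, rfl⟩ := e.surjective i
    rcases a with a | m
    · fin_cases a
      · simpa [hz, Pi.single_apply] using hasDerivAt_const s t
      · simpa [hz] using hasDerivAt_id' s
    · simpa [hz] using hasDerivAt_const s (w m)
  have hcont0 : ∀ s, Continuous fun t => z t s := fun s => continuous_pi fun i =>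
    continuous_iff_continuousAt.2 fun t => (hw0 t s i).continuousAt
  have hcont1 : ∀ t, Continuous (z t) := fun t => continuous_pi fun i =>
    continuous_iff_continuousAt.2 fun s => (hw1 t s i).continuousAt
  have hinner : ∀ t a, ∫ s in Set.Iic a, ((P⁻¹).mulVec (z t s) (e (Sum.inl 0)) *
      (P⁻¹).mulVec (z t s) (e (Sum.inl 1)) - P⁻¹ (e (Sum.inl 1)) (e (Sum.inl 0))) *
        mvnDensity 0 P (z t s) =
      -(P⁻¹).mulVec (z t a) (e (Sum.inl 0)) * mvnDensity 0 P (z t a) := by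
    intro t a
    have hc1 := hcont1 t
    refine setIntegral_Iic_deriv_of_gaussian_tails
      (F := fun s => -(P⁻¹).mulVec (z t s) (e (Sum.inl 0)) * mvnDensity 0 P (z t s))
      (C := C) hc (fun s => ?_) (by fun_prop) (fun s => ?_) (fun s => ?_) a
    · have hs : P⁻¹ (e (Sum.inl 0)) (e (Sum.inl 1)) = P⁻¹ (e (Sum.inl 1)) (e (Sum.inl 0)) := by
        conv_lhs => rw [← transpose_inv_eq_of_posDef hP]
        rfl
      have h1 := hasDerivAt_linear_mul_mvnDensity_comp (hw1 t s) hP (Pi.single (e (Sum.inl 0)) 1)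
      simp only [single_one_dotProduct, Matrix.mulVec_single_one, Matrix.col_apply] at h1
      refine h1.congr_deriv ?_
      rw [hs]
      ring
    · exact ((h _).2.1 _).trans (hle' t s)
    · exact ((h _).2.2 _ _).trans (hle' t s)
  rw [setIntegral_Iic_fin_two]
  · change ∫ t in Set.Iic _, ∫ s in Set.Iic _, ((P⁻¹).mulVec (z t s) (e (Sum.inl 0)) *
      (P⁻¹).mulVec (z t s) (e (Sum.inl 1)) - P⁻¹ (e (Sum.inl 1)) (e (Sum.inl 0))) *
        mvnDensity 0 P (z t s) = _
    simp only [hinner]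
    have hc0 := hcont0 ((b ∘ e ∘ Sum.inl) 1)
    have hbe : (b ∘ e ∘ Sum.inl : Fin 2 → ℝ) =
        ![(b ∘ e ∘ Sum.inl) 0, (b ∘ e ∘ Sum.inl) 1] := by
      ext a; fin_cases a <;> rfl
    conv_rhs => rw [hbe]
    refine setIntegral_Iic_deriv_of_gaussian_tails
      (F := fun t => mvnDensity 0 P (z t ((b ∘ e ∘ Sum.inl) 1)))
      (C := C) hc (fun t => ?_) (by fun_prop) (fun t => ?_) (fun t => ?_) _
    · exact (hasDerivAt_mvnDensity_comp (hw0 t _) hP).congr_deriv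
        (by simp only [single_one_dotProduct])
    · rw [abs_of_pos (mvnDensity_pos hP.det_pos _ _)]
      exact (h _).1.trans (hle t _)
    · exact ((h _).2.1 _).trans (hle t _)
  · set Z : (Fin 2 → ℝ) → ι → ℝ := fun x => Sum.elim x w ∘ e.symm with hZ
    have hzc : Continuous Z := by
      refine continuous_pi fun i => ?_
      obtain ⟨a, rfl⟩ := e.surjective i
      rcases a with a | m
      · simpa [hZ] using continuous_apply a
      · simpa [hZ] using continuous_const
    change Integrable fun x => ((P⁻¹).mulVec (Z x) (e (Sum.inl 0)) *
      (P⁻¹).mulVec (Z x) (e (Sum.inl 1)) - P⁻¹ (e (Sum.inl 1)) (e (Sum.inl 0))) *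
        mvnDensity 0 P (Z x)
    refine ((integrable_exp_neg_sum_sq hc).const_mul C).mono'
      (Continuous.aestronglyMeasurable (by fun_prop)) (ae_of_all _ fun x => ?_)
    refine ((h _).2.2 _ _).trans ?_
    rw [hZ, sum_sq_sumElim e]
    refine mul_le_mul_of_nonneg_left (Real.exp_le_exp.2 ?_) hC.le
    nlinarith [mul_nonneg hc.le h0]

end Generic

/-! ### Orthant integrals for matrices with unit diagonal -/

section Corr

variable {d : ℕ} {P : Matrix (Fin d) (Fin d) ℝ}

/-- The integral of a first order partial derivative of the normal density over an orthant. -/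
theorem setIntegral_Iic_partial_eq (hP : P.PosDef) {k : Fin d} (hk : P k k = 1)
    (b : Fin d → ℝ) :
    ∫ z in Set.Iic b, -(P⁻¹).mulVec z k * mvnDensity 0 P z =
      ProbabilityTheory.gaussianPDFReal 0 1 (b k) *
        mvnCdf (fun m : Rest1 k => (b m : EReal)) (condMean1 P k (b k)) (condCov1 P k) := by
  let e : Unit ⊕ Rest1 k ≃ Fin d := splitEquiv (fun _ => k) (fun _ _ _ => rfl) _
    (fun m => ⟨fun h _ => Ne.symm h, fun h => (h ()).symm⟩)
  -- The conditioning block is the single entry `P k k = 1`, so the inverse disappears from the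
  -- conditional mean and covariance.
  have hone : P.submatrix (e ∘ Sum.inl) (e ∘ Sum.inl) = 1 := by
    ext a a'
    simpa [Matrix.one_apply] using! hk
  have h1 := setIntegral_Iic_partial_mvnDensity e hP b
  rw [setIntegral_Iic_mvnDensity_sumElim e hP] at h1
  have h2 : blockMean P (e ∘ Sum.inl) (e ∘ Sum.inr) (b ∘ e ∘ Sum.inl) = condMean1 P k (b k) := by
    rw [blockMean, hone, inv_one, Matrix.mul_one]
    funext m
    simp [Matrix.mulVec, dotProduct, condMean1]
    rfl
  have h3 : blockCov P (e ∘ Sum.inl) (e ∘ Sum.inr) = condCov1 P k := by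
    rw [blockCov, hone, inv_one, Matrix.mul_one]
    ext m m'
    simp [Matrix.mul_apply, condCov1]
    rfl
  rw [h2, h3, hone] at h1
  refine h1.trans ?_
  congr 1
  rw [mvnDensity, ProbabilityTheory.gaussianPDFReal]
  simp [dotProduct, sq, div_eq_inv_mul]
  left
  congr 1

/-- The integral of a mixed second order derivative of the normal density over an orthant. -/
theorem setIntegral_Iic_partial₂_eq (hP : P.PosDef) (hdiag : ∀ k, P k k = 1) {i j : Fin d}
    (hij : i ≠ j) (b : Fin d → ℝ) :
    ∫ z in Set.Iic b, ((P⁻¹).mulVec z i * (P⁻¹).mulVec z j - P⁻¹ j i) * mvnDensity 0 P z =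
      phi2 (b i) (b j) (P i j) *
        mvnCdf (fun m : Rest2 i j => (b m : EReal)) (condMean2 P i j ![b i, b j])
          (condCov2 P i j) := by
  have hinj : Function.Injective ![i, j] := by
    intro a a'
    fin_cases a <;> fin_cases a' <;> simp [hij, hij.symm]
  let e : Fin 2 ⊕ Rest2 i j ≃ Fin d := splitEquiv ![i, j] hinj _ (fun m => by
    simp [Fin.forall_fin_two, eq_comm])
  have hinl : (e ∘ Sum.inl : Fin 2 → Fin d) = ![i, j] := rfl
  have hinr : (e ∘ Sum.inr : Rest2 i j → Fin d) = Subtype.val := rfl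
  have h1 := setIntegral_Iic_partial₂_mvnDensity e hP b
  have hb : b ∘ e ∘ Sum.inl = ![b i, b j] := by
    rw [hinl]
    ext a
    fin_cases a <;> rfl
  rw [setIntegral_Iic_mvnDensity_sumElim e hP, hb, hinl, hinr] at h1
  refine h1.trans ?_
  have hs : P j i = P i j := by
    have : P.transpose = P := by simpa using hP.isHermitian.eq
    conv_lhs => rw [← this]
    rfl
  have hsub : P.submatrix ![i, j] ![i, j] = !![1, P i j; P i j, 1] := by
    ext a a'
    fin_cases a <;> fin_cases a' <;> simp [hdiag, hs]
  have h2 : phi2 (b i) (b j) (P i j) =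
      mvnDensity 0 (P.submatrix ![i, j] ![i, j]) ![b i, b j] := by
    rw [hsub, phi2, if_neg (by simp)]
    simp
  rw [h2]
  rfl

end Corr

/-! ### The standard normal quantile function -/

section Quantile

open ProbabilityTheory

theorem cdf_gaussianReal_eq_integral (x : ℝ) :
    cdf (gaussianReal 0 1) x = ∫ y in Set.Iic x, gaussianPDFReal 0 1 y := by
  rw [cdf_eq_real, measureReal_def, gaussianReal_apply_eq_integral _ one_ne_zero,
    ENNReal.toReal_ofReal]
  exact integral_nonneg fun y => gaussianPDFReal_nonneg _ _ _

theorem hasDerivAt_cdf_gaussianReal (x : ℝ) :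
    HasDerivAt (fun x => cdf (gaussianReal 0 1) x) (gaussianPDFReal 0 1 x) x := by
  have hc : Continuous (gaussianPDFReal 0 1) := by
    rw [gaussianPDFReal_def]
    fun_prop
  have hi := integrable_gaussianPDFReal 0 1
  have h1 : ∀ x, cdf (gaussianReal 0 1) x =
      (∫ y in Set.Iic (0 : ℝ), gaussianPDFReal 0 1 y) + ∫ y in (0 : ℝ)..x, gaussianPDFReal 0 1 y := by
    intro x
    rw [cdf_gaussianReal_eq_integral,
      ← intervalIntegral.integral_Iic_sub_Iic hi.integrableOn hi.integrableOn]
    ring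
  simp only [h1]
  exact (intervalIntegral.integral_hasDerivAt_right (hc.intervalIntegrable _ _)
    (hc.stronglyMeasurableAtFilter _ _) hc.continuousAt).const_add _

theorem strictMono_cdf_gaussianReal : StrictMono fun x => cdf (gaussianReal 0 1) x :=
  strictMono_of_hasDerivAt_pos hasDerivAt_cdf_gaussianReal
    fun _ => gaussianPDFReal_pos _ _ _ one_ne_zero

theorem cdf_gaussianReal_mem_Ioo (x : ℝ) : cdf (gaussianReal 0 1) x ∈ Set.Ioo (0 : ℝ) 1 :=
  ⟨(cdf_nonneg _ (x - 1)).trans_lt (strictMono_cdf_gaussianReal (sub_one_lt x)),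
    (strictMono_cdf_gaussianReal (lt_add_one x)).trans_le (cdf_le_one _ _)⟩

theorem exists_cdf_gaussianReal_eq {u : ℝ} (hu : u ∈ Set.Ioo (0 : ℝ) 1) :
    ∃ x, cdf (gaussianReal 0 1) x = u := by
  have hc : Continuous fun x => cdf (gaussianReal 0 1) x :=
    continuous_iff_continuousAt.2 fun x => (hasDerivAt_cdf_gaussianReal x).continuousAt
  obtain ⟨a, ha⟩ := ((tendsto_cdf_atBot (gaussianReal 0 1)).eventually_lt_const hu.1).exists
  obtain ⟨b, hb⟩ := ((tendsto_cdf_atTop (gaussianReal 0 1)).eventually_const_lt hu.2).exists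
  exact mem_range_of_exists_le_of_exists_ge hc ⟨a, ha.le⟩ ⟨b, hb.le⟩

theorem stdNormalQuantile_cdf (x : ℝ) :
    stdNormalQuantile (cdf (gaussianReal 0 1) x) = (x : EReal) := by
  have h1 : {x' : ℝ | cdf (gaussianReal 0 1) x ≤ cdf (gaussianReal 0 1) x'} = Set.Ici x := by
    ext x'
    exact strictMono_cdf_gaussianReal.le_iff_le
  rw [stdNormalQuantile, h1]
  refine (IsLeast.csInf_eq ⟨Set.mem_image_of_mem _ Set.self_mem_Ici, ?_⟩)
  rintro _ ⟨x', hx', rfl⟩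
  exact EReal.coe_le_coe_iff.2 hx'

theorem stdNormalQuantile_zero : stdNormalQuantile 0 = ⊥ := by
  rw [stdNormalQuantile, eq_bot_iff]
  refine EReal.le_of_forall_lt_iff_le.1 fun x _ => sInf_le ?_
  exact Set.mem_image_of_mem _ (cdf_nonneg _ _)

/-- The real-valued standard normal quantile function. -/
noncomputable def realQuantile (u : ℝ) : ℝ := (stdNormalQuantile u).toReal

theorem realQuantile_cdf (x : ℝ) : realQuantile (cdf (gaussianReal 0 1) x) = x := by
  rw [realQuantile, stdNormalQuantile_cdf, EReal.toReal_coe]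

theorem coe_realQuantile {u : ℝ} (hu : u ∈ Set.Ioo (0 : ℝ) 1) :
    (realQuantile u : EReal) = stdNormalQuantile u := by
  obtain ⟨x, rfl⟩ := exists_cdf_gaussianReal_eq hu
  rw [realQuantile_cdf, stdNormalQuantile_cdf]

theorem cdf_realQuantile {u : ℝ} (hu : u ∈ Set.Ioo (0 : ℝ) 1) :
    cdf (gaussianReal 0 1) (realQuantile u) = u := by
  obtain ⟨x, rfl⟩ := exists_cdf_gaussianReal_eq hu
  rw [realQuantile_cdf]

theorem strictMonoOn_realQuantile : StrictMonoOn realQuantile (Set.Ioo 0 1) := by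
  intro u hu v hv huv
  rw [← strictMono_cdf_gaussianReal.lt_iff_lt]
  simpa only [cdf_realQuantile hu, cdf_realQuantile hv] using huv

/-- The inverse function rule. The continuity it requires holds because the quantile is strictly
monotone on $(0,1)$ and maps it onto $\mathbb R$. -/
theorem hasDerivAt_realQuantile {u : ℝ} (hu : u ∈ Set.Ioo (0 : ℝ) 1) :
    HasDerivAt realQuantile (gaussianPDFReal 0 1 (realQuantile u))⁻¹ u := by
  have hn : Set.Ioo (0 : ℝ) 1 ∈ 𝓝 u := isOpen_Ioo.mem_nhds hu
  refine HasDerivAt.of_local_left_inverse (f := fun x => cdf (gaussianReal 0 1) x) ?_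
    (hasDerivAt_cdf_gaussianReal _) (gaussianPDFReal_pos _ _ _ one_ne_zero).ne' ?_
  · refine strictMonoOn_realQuantile.continuousAt_of_image_mem_nhds hn ?_
    have : realQuantile '' Set.Ioo 0 1 = Set.univ := Set.eq_univ_of_forall fun x =>
      ⟨_, cdf_gaussianReal_mem_Ioo x, realQuantile_cdf x⟩
    rw [this]
    exact univ_mem
  · filter_upwards [hn] with v hv using cdf_realQuantile hv

theorem stdNormalQuantile_lt {u v : ℝ} (hu : 0 ≤ u) (huv : u < v) (hv : v < 1) :
    stdNormalQuantile u < stdNormalQuantile v := by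
  have hv' : v ∈ Set.Ioo (0 : ℝ) 1 := ⟨hu.trans_lt huv, hv⟩
  rw [← coe_realQuantile hv']
  rcases hu.eq_or_lt with rfl | hu
  · rw [stdNormalQuantile_zero]
    exact EReal.bot_lt_coe _
  · have hu' : u ∈ Set.Ioo (0 : ℝ) 1 := ⟨hu, huv.trans hv⟩
    rw [← coe_realQuantile hu', EReal.coe_lt_coe_iff]
    exact strictMonoOn_realQuantile hu' hv' huv

end Quantile

/-! ### Poisson distribution functions as functions of the mean -/

section Poisson

open ProbabilityTheory

theorem poissonPmf_natCast {l : ℝ} (hl : 0 ≤ l) (n : ℕ) :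
    poissonPmf l n = Real.exp (-l) * l ^ n / n.factorial := by
  have h : {k : ℕ | (k : ℤ) = n} = {n} := by ext; simp
  rw [poissonPmf, h, poissonMeasure_real_singleton, Real.coe_toNNReal _ hl]

theorem poissonPmf_of_neg (l : ℝ) {m : ℤ} (hm : m < 0) : poissonPmf l m = 0 := by
  have h : {k : ℕ | (k : ℤ) = m} = ∅ := by
    ext k
    simp only [Set.mem_ofPred_eq, Set.mem_empty_iff_false, iff_false]
    omega
  rw [poissonPmf, h, measureReal_empty]

theorem poissonCdf_of_neg (l : ℝ) {m : ℤ} (hm : m < 0) : poissonCdf l m = 0 := by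
  have h : {k : ℕ | (k : ℤ) ≤ m} = ∅ := by
    ext k
    simp only [Set.mem_ofPred_eq, Set.mem_empty_iff_false, iff_false]
    omega
  rw [poissonCdf, h, measureReal_empty]

theorem poissonCdf_natCast {l : ℝ} (hl : 0 ≤ l) (n : ℕ) :
    poissonCdf l n = ∑ k ∈ Finset.range (n + 1), Real.exp (-l) * l ^ k / k.factorial := by
  have h : {k : ℕ | (k : ℤ) ≤ n} = (Finset.range (n + 1) : Set ℕ) := by
    ext k
    simp only [Set.mem_ofPred_eq, Finset.coe_range, Set.mem_Iio]
    omega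
  rw [poissonCdf, h, ← sum_measureReal_singleton]
  refine Finset.sum_congr rfl fun k _ => ?_
  rw [poissonMeasure_real_singleton, Real.coe_toNNReal _ hl]

theorem poissonCdf_nonneg (l : ℝ) (m : ℤ) : 0 ≤ poissonCdf l m := measureReal_nonneg

theorem poissonCdf_sub_one_lt {l : ℝ} (hl : 0 < l) (n : ℕ) :
    poissonCdf l ((n : ℤ) - 1) < poissonCdf l n := by
  rcases n with _ | n
  · rw [poissonCdf_of_neg _ (by simp), poissonCdf_natCast hl.le]
    simp [Real.exp_pos]
  · have h : (((n + 1 : ℕ) : ℤ) - 1) = (n : ℤ) := by push_cast; ring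
    rw [h, poissonCdf_natCast hl.le, poissonCdf_natCast hl.le, Finset.sum_range_succ _ (n + 1)]
    have : 0 < Real.exp (-l) * l ^ (n + 1) / (n + 1).factorial := by positivity
    linarith

/-- The distribution function still increases strictly from `n` to `n + 1`, where it is at most `1`.
-/
theorem poissonCdf_lt_one {l : ℝ} (hl : 0 < l) (n : ℕ) : poissonCdf l n < 1 := by
  have h := poissonCdf_sub_one_lt hl (n + 1)
  rw [show (((n + 1 : ℕ) : ℤ) - 1) = (n : ℤ) by push_cast; ring] at h
  exact h.trans_le measureReal_le_one

theorem poissonCdf_mem_Ioo {l : ℝ} (hl : 0 < l) {m : ℤ} (hm : 0 ≤ m) :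
    poissonCdf l m ∈ Set.Ioo (0 : ℝ) 1 := by
  lift m to ℕ using hm
  exact ⟨(poissonCdf_nonneg _ _).trans_lt (poissonCdf_sub_one_lt hl m), poissonCdf_lt_one hl m⟩

/-- Each mass satisfies $f'(k)=f(k-1)-f(k)$ in the mean, so the derivative of the partial sum
telescopes to $-f(m)$. -/
theorem hasDerivAt_poissonCdf {l : ℝ} (hl : 0 < l) (m : ℤ) :
    HasDerivAt (fun x => poissonCdf x m) (-poissonPmf l m) l := by
  rcases lt_or_ge m 0 with hm | hm
  · simp only [poissonCdf_of_neg _ hm, poissonPmf_of_neg _ hm, neg_zero]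
    exact hasDerivAt_const _ _
  lift m to ℕ using hm
  -- The truncation `Real.toNNReal` is inactive only for nonnegative means, so the explicit sum is
  -- used only near `l > 0`.
  have hev : (fun x => poissonCdf x m) =ᶠ[𝓝 l]
      fun x => ∑ k ∈ Finset.range (m + 1), Real.exp (-x) * x ^ k / k.factorial := by
    filter_upwards [lt_mem_nhds hl] with x hx using poissonCdf_natCast hx.le m
  refine HasDerivAt.congr_of_eventuallyEq ?_ hev
  rw [poissonPmf_natCast hl.le]
  induction m with
  | zero =>
    simp only [zero_add, Finset.range_one, Finset.sum_singleton, pow_zero, mul_one,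
      Nat.factorial_zero, Nat.cast_one, div_one]
    simpa using (hasDerivAt_neg l).exp
  | succ n ih =>
    simp only [Finset.sum_range_succ _ (n + 1)]
    have h1 : (fun x => poissonCdf x n) =ᶠ[𝓝 l]
        fun x => ∑ k ∈ Finset.range (n + 1), Real.exp (-x) * x ^ k / k.factorial := by
      filter_upwards [lt_mem_nhds hl] with x hx using poissonCdf_natCast hx.le n
    have h2 := (((hasDerivAt_neg l).exp.mul (hasDerivAt_pow (n + 1) l)).div_const
      ((n + 1).factorial : ℝ))
    refine ((ih h1).add h2).congr_deriv ?_
    rw [Nat.factorial_succ]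
    have : (n.factorial : ℝ) ≠ 0 := by positivity
    push_cast
    field_simp
    simp

theorem stdNormalQuantile_poissonCdf_of_neg (l : ℝ) {m : ℤ} (hm : m < 0) :
    stdNormalQuantile (poissonCdf l m) = ⊥ := by
  rw [poissonCdf_of_neg _ hm, stdNormalQuantile_zero]

theorem hasDerivAt_realQuantile_poissonCdf {l : ℝ} (hl : 0 < l) {m : ℤ} (hm : 0 ≤ m) :
    HasDerivAt (fun x => realQuantile (poissonCdf x m))
      ((gaussianPDFReal 0 1 (realQuantile (poissonCdf l m)))⁻¹ * -poissonPmf l m) l :=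
  HasDerivAt.comp (h₂ := realQuantile) l (hasDerivAt_realQuantile (poissonCdf_mem_Ioo hl hm))
    (hasDerivAt_poissonCdf hl m)

end Poisson

/-! ### Positivity of the joint mass function and inclusion-exclusion -/

variable {d : ℕ}

/-- The rectangle over which the density is integrated in `jointPmf`. -/
def cell (l : Fin d → ℝ) (y : Fin d → ℕ) : Set (Fin d → ℝ) :=
  {z | ∀ j, latent l (fun i => (y i : ℤ) - 1) j < ((z j : ℝ) : EReal) ∧
    ((z j : ℝ) : EReal) ≤ latent l (fun i => (y i : ℤ)) j}

theorem measurableSet_setOf_forall_le (b : Fin d → EReal) :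
    MeasurableSet {z : Fin d → ℝ | ∀ j, ((z j : ℝ) : EReal) ≤ b j} := by
  simp only [Set.ofPred_forall]
  exact MeasurableSet.iInter fun j => measurableSet_le (by fun_prop) measurable_const

theorem measurableSet_cell (l : Fin d → ℝ) (y : Fin d → ℕ) : MeasurableSet (cell l y) := by
  unfold cell
  simp only [Set.ofPred_forall]
  refine MeasurableSet.iInter fun j => ?_
  have h : Measurable fun z : Fin d → ℝ => ((z j : ℝ) : EReal) := by fun_prop
  exact (measurableSet_lt measurable_const h).inter (measurableSet_le h measurable_const)

theorem latent_sub_one_lt {l : Fin d → ℝ} (hl : ∀ j, 0 < l j) (y : Fin d → ℕ) (j : Fin d) :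
    latent l (fun i => (y i : ℤ) - 1) j < latent l (fun i => (y i : ℤ)) j :=
  stdNormalQuantile_lt (poissonCdf_nonneg _ _) (poissonCdf_sub_one_lt (hl j) (y j))
    (poissonCdf_lt_one (hl j) (y j))

/-- The density is positive everywhere and the cell contains a nonempty open box, because Poisson
masses are positive and so consecutive quantiles differ. -/
theorem jointPmf_pos {l : Fin d → ℝ} (hl : ∀ j, 0 < l j) {P : Matrix (Fin d) (Fin d) ℝ}
    (hP : P.PosDef) (y : Fin d → ℕ) : 0 < jointPmf l P y := by
  have hsupp : Function.support (mvnDensity 0 P) = Set.univ :=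
    Set.eq_univ_of_forall fun z => (mvnDensity_pos hP.det_pos 0 z).ne'
  change 0 < ∫ z in cell l y, mvnDensity 0 P z
  rw [setIntegral_pos_iff_support_of_nonneg_ae
    (ae_of_all _ fun z => (mvnDensity_pos hP.det_pos 0 z).le)
    (integrable_mvnDensity_zero hP).integrableOn, hsupp, Set.univ_inter]
  set U : Set (Fin d → ℝ) := Set.univ.pi fun j =>
    {x : ℝ | latent l (fun i => (y i : ℤ) - 1) j < (x : EReal) ∧
      (x : EReal) < latent l (fun i => (y i : ℤ)) j} with hU
  have hsub : U ⊆ cell l y := fun z hz j => ⟨(hz j trivial).1, (hz j trivial).2.le⟩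
  have hopen : IsOpen U := isOpen_set_pi Set.finite_univ fun j _ =>
    (isOpen_lt continuous_const continuous_coe_real_ereal).inter
      (isOpen_lt continuous_coe_real_ereal continuous_const)
  have hne : U.Nonempty := by
    choose x hx using fun j => EReal.lt_iff_exists_real_btwn.1 (latent_sub_one_lt hl y j)
    exact ⟨x, fun j _ => hx j⟩
  exact (hopen.measure_pos volume hne).trans_le (measure_mono hsub)

/-- The indicator of the cell is the product over $j$ of differences of two half-line indicators;
expanding the product by distributivity produces the signed corners. -/
theorem indicator_cell_eq_sum {l : Fin d → ℝ} (hl : ∀ j, 0 < l j) (y : Fin d → ℕ)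
    (g : (Fin d → ℝ) → ℝ) (z : Fin d → ℝ) :
    (cell l y).indicator g z = ∑ t : Fin d → Fin 2, cornerSign t *
      {z : Fin d → ℝ | ∀ j, ((z j : ℝ) : EReal) ≤ latent l (corner y t) j}.indicator g z := by
  classical
  set c : Fin d → Fin 2 → ℝ := fun j s => (-1) ^ (s : ℕ) *
    if ((z j : ℝ) : EReal) ≤ stdNormalQuantile (poissonCdf (l j) ((y j : ℤ) - ((s : ℕ) : ℤ)))
      then 1 else 0 with hc
  have h1 : ∀ t : Fin d → Fin 2, cornerSign t *
      {z : Fin d → ℝ | ∀ j, ((z j : ℝ) : EReal) ≤ latent l (corner y t) j}.indicator g z =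
      (∏ j, c j (t j)) * g z := by
    intro t
    rw [hc]
    simp only
    rw [Finset.prod_mul_distrib, Finset.prod_ite_zero, Finset.prod_pow_eq_pow_sum, cornerSign,
      Set.indicator_apply, mul_assoc]
    congr 1
    simp only [Set.mem_ofPred_eq, latent, corner, Finset.mem_univ, true_imp_iff,
      Finset.prod_const_one, ite_mul, one_mul, zero_mul]
    congr
  have h2 : ∀ j, ∑ s, c j s = if latent l (fun i => (y i : ℤ) - 1) j < ((z j : ℝ) : EReal) ∧
    ((z j : ℝ) : EReal) ≤ latent l (fun i => (y i : ℤ)) j then 1 else 0 := by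
    intro j
    have h3 := latent_sub_one_lt hl y j
    have hc0 : c j 0 =
        if ((z j : ℝ) : EReal) ≤ latent l (fun i => (y i : ℤ)) j then 1 else 0 := by
      simp only [hc, latent, Fin.val_zero, pow_zero, one_mul, Nat.cast_zero, sub_zero]
      congr
    have hc1 : c j 1 =
        -if ((z j : ℝ) : EReal) ≤ latent l (fun i => (y i : ℤ) - 1) j then 1 else 0 := by
      simp only [hc, latent, Fin.val_one, pow_one, neg_mul, one_mul, Nat.cast_one]
      congr
    rw [Fin.sum_univ_two, hc0, hc1]
    by_cases ha : ((z j : ℝ) : EReal) ≤ latent l (fun i => (y i : ℤ) - 1) j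
    · rw [if_pos ha, if_pos (ha.trans h3.le), if_neg fun h => not_lt.2 ha h.1]
      norm_num
    · rw [if_neg ha]
      simp only [not_le.1 ha, true_and]
      ring
  rw [Finset.sum_congr rfl fun t _ => h1 t, ← Finset.sum_mul, ← Fintype.piFinset_univ,
    ← Finset.prod_univ_sum, Finset.prod_congr rfl fun j _ => h2 j, Finset.prod_ite_zero,
    Set.indicator_apply]
  simp only [cell, Set.mem_ofPred_eq, Finset.mem_univ, true_imp_iff, Finset.prod_const_one,
    ite_mul, one_mul, zero_mul]
  congr

/-- Inclusion-exclusion for the joint probability mass function. -/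
theorem jointPmf_eq_sum {l : Fin d → ℝ} (hl : ∀ j, 0 < l j) {P : Matrix (Fin d) (Fin d) ℝ}
    (hP : P.PosDef) (y : Fin d → ℕ) :
    jointPmf l P y = ∑ t : Fin d → Fin 2, cornerSign t * jointCdf l P (corner y t) := by
  have hi := integrable_mvnDensity_zero hP
  change ∫ z in cell l y, mvnDensity 0 P z = _
  rw [← integral_indicator (measurableSet_cell l y)]
  simp only [indicator_cell_eq_sum hl]
  rw [integral_finsetSum]
  · refine Finset.sum_congr rfl fun t _ => ?_
    rw [integral_const_mul, integral_indicator (measurableSet_setOf_forall_le _)]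
    rfl
  · exact fun t _ => (hi.indicator (measurableSet_setOf_forall_le _)).const_mul _

theorem mvnCdf_eq_zero_of_bot {ι : Type} [Fintype ι] [DecidableEq ι] {b : ι → EReal} {j : ι}
    (hj : b j = ⊥) (μ : ι → ℝ) (S : Matrix ι ι ℝ) : mvnCdf b μ S = 0 := by
  have h : {z : ι → ℝ | ∀ j, ((z j : ℝ) : EReal) ≤ b j} = ∅ := by
    refine Set.eq_empty_of_forall_notMem fun z hz => ?_
    have := hz j
    rw [hj, le_bot_iff] at this
    exact EReal.coe_ne_bot _ this
  rw [mvnCdf, h, Measure.restrict_empty, integral_zero_measure]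

/-! ### Total derivatives of the distribution and mass functions -/

/-- The form of `A p₀` is at least $|x|^2/c$, and an entrywise perturbation of size $\delta$ changes
it by at most $|x|^2/(2c)$. -/
theorem eventually_posDef {ι : Type} [Fintype ι] [DecidableEq ι] {E : Type*} [TopologicalSpace E]
    {A : E → Matrix ι ι ℝ} {p₀ : E} (hc : ∀ i j, ContinuousAt (fun p => A p i j) p₀)
    (hs : ∀ p, (A p).transpose = A p) (h0 : (A p₀).PosDef) : ∀ᶠ p in 𝓝 p₀, (A p).PosDef := by
  set K : ℝ := ∑ i, ∑ j, |(A p₀)⁻¹ i j| with hK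
  have hKle : ∀ i j, |(A p₀)⁻¹ i j| ≤ K := fun i j =>
    (Finset.single_le_sum (f := fun j => |(A p₀)⁻¹ i j|) (fun _ _ => abs_nonneg _)
      (Finset.mem_univ j)).trans (Finset.single_le_sum (f := fun i => ∑ j, |(A p₀)⁻¹ i j|)
        (fun _ _ => by positivity) (Finset.mem_univ i))
  set c : ℝ := K * Fintype.card ι + 1 with hcdef
  have hcpos : 0 < c := by positivity
  set δ : ℝ := 1 / (2 * c * (Fintype.card ι + 1)) with hδ
  have hδpos : 0 < δ := by positivity
  have hev : ∀ᶠ p in 𝓝 p₀, ∀ i j, |(A p₀ - A p) i j| ≤ δ := by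
    refine eventually_all.2 fun i => eventually_all.2 fun j => ?_
    have h1 : ContinuousAt (fun p => |(A p₀ - A p) i j|) p₀ :=
      (continuousAt_const.sub (hc i j)).abs
    exact (h1.eventually_lt_const (by simpa using hδpos)).mono fun _ h => h.le
  filter_upwards [hev] with p hp
  refine Matrix.PosDef.of_dotProduct_mulVec_pos
    (by rw [Matrix.IsHermitian, Matrix.conjTranspose_eq_transpose_of_trivial, hs])
    fun x hx => ?_
  -- Applied to the inverse matrix, the bound becomes a lower bound for the form of `A p₀` itself.
  have h1 := inv_quadForm_ge_of_entries_le h0.inv (by positivity) hKle x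
  rw [Matrix.nonsing_inv_nonsing_inv _ h0.det_pos.ne'.isUnit, ← hcdef] at h1
  have h2 := quadForm_le_of_entries_le hp x
  rw [Matrix.sub_mulVec, dotProduct_sub] at h2
  have h3 : 0 < ∑ i, x i ^ 2 := by
    obtain ⟨i, hi⟩ := Function.ne_iff.1 hx
    exact Finset.sum_pos' (fun _ _ => sq_nonneg _) ⟨i, Finset.mem_univ i, by
      have : x i ≠ 0 := hi
      positivity⟩
  have h4 : δ * Fintype.card ι ≤ 1 / (2 * c) := by
    rw [hδ, div_mul_eq_mul_div, one_mul, div_le_div_iff₀ (by positivity) (by positivity)]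
    nlinarith
  have h5 : δ * Fintype.card ι * ∑ i, x i ^ 2 ≤ 1 / (2 * c) * ∑ i, x i ^ 2 := by gcongr
  have h6 : 1 / (2 * c) * ∑ i, x i ^ 2 = (∑ i, x i ^ 2) / c / 2 := by field_simp
  have h7 : 0 < (∑ i, x i ^ 2) / c := by positivity
  rw [star_trivial]
  linarith

theorem corrMatrix_transpose (ϱ : StrictLower d → ℝ) : (corrMatrix ϱ).transpose = corrMatrix ϱ := by
  ext i j
  simp only [corrMatrix, Matrix.transpose_apply, Matrix.of_apply]
  rcases lt_trichotomy i j with h | rfl | h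
  · simp [h, h.not_gt]
  · rfl
  · simp [h, h.not_gt]

theorem corrMatrix_diag (ϱ : StrictLower d → ℝ) (k : Fin d) : corrMatrix ϱ k k = 1 := by
  simp [corrMatrix]

theorem corrMatrix_vechs {P : Matrix (Fin d) (Fin d) ℝ} (hs : P.transpose = P)
    (hd : ∀ k, P k k = 1) : corrMatrix (vechs P) = P := by
  ext i j
  simp only [corrMatrix, Matrix.of_apply, vechs]
  rcases lt_trichotomy i j with h | rfl | h
  · rw [dif_neg h.not_gt, dif_pos h]
    conv_rhs => rw [← hs]
    rfl
  · simp [hd]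
  · rw [dif_pos h]

theorem contDiff_corrMatrix_apply (i j : Fin d) :
    ContDiff ℝ 1 fun ϱ : StrictLower d → ℝ => corrMatrix ϱ i j := by
  simp only [corrMatrix, Matrix.of_apply]
  split_ifs <;> fun_prop

theorem corrMatrix_add_smul_single (ϱ : StrictLower d → ℝ) (κ : StrictLower d) (s : ℝ) :
    corrMatrix (ϱ + s • Pi.single κ 1) =
      corrMatrix ϱ + s • (Matrix.single κ.1.1 κ.1.2 1 + Matrix.single κ.1.2 κ.1.1 1) := by
  obtain ⟨⟨i, j⟩, hκ⟩ := κ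
  ext a b
  simp only [corrMatrix, Matrix.of_apply, Matrix.add_apply, Matrix.smul_apply, Pi.add_apply,
    Pi.smul_apply, Matrix.single_apply, Pi.single_apply, Subtype.mk.injEq, Prod.mk.injEq,
    smul_eq_mul]
  simp only at hκ
  split_ifs <;> first | omega | simp

theorem setIntegral_Iic_zero_comp_add (f : (Fin d → ℝ) → ℝ) (b : Fin d → ℝ) :
    ∫ u in Set.Iic 0, f (u + b) = ∫ z in Set.Iic b, f z := by
  simpa using (measurePreserving_add_right volume b).setIntegral_preimage_emb
    (measurableEmbedding_addRight b) f (Set.Iic b)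

/-- Total differentiability of the normal distribution function in its argument and in the
correlations, with the partial derivatives. -/
theorem exists_hasFDerivAt_mvnCdf {ϱ : StrictLower d → ℝ} (hP : (corrMatrix ϱ).PosDef)
    (b : Fin d → ℝ) :
    ∃ D : (Fin d → ℝ) × (StrictLower d → ℝ) →L[ℝ] ℝ,
      HasFDerivAt (fun p : (Fin d → ℝ) × (StrictLower d → ℝ) =>
        mvnCdf (fun j => (p.1 j : EReal)) 0 (corrMatrix p.2)) D (b, ϱ) ∧
      (∀ k, D (Pi.single k 1, 0) = ProbabilityTheory.gaussianPDFReal 0 1 (b k) *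
        mvnCdf (fun m : Rest1 k => (b m : EReal)) (condMean1 (corrMatrix ϱ) k (b k))
          (condCov1 (corrMatrix ϱ) k)) ∧
      ∀ κ, D (0, Pi.single κ 1) =
        phi2 (b κ.1.1) (b κ.1.2) (corrMatrix ϱ κ.1.1 κ.1.2) *
          mvnCdf (fun m : Rest2 κ.1.1 κ.1.2 => (b m : EReal))
            (condMean2 (corrMatrix ϱ) κ.1.1 κ.1.2 ![b κ.1.1, b κ.1.2])
            (condCov2 (corrMatrix ϱ) κ.1.1 κ.1.2) := by
  set p₀ : (Fin d → ℝ) × (StrictLower d → ℝ) := (b, ϱ) with hp₀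
  have hcd : ∀ i j, ContDiff ℝ 1 fun p : (Fin d → ℝ) × (StrictLower d → ℝ) =>
      corrMatrix p.2 i j := fun i j => (contDiff_corrMatrix_apply i j).comp contDiff_snd
  obtain ⟨h1, h2, h3⟩ := hasFDerivAt_setIntegral_mvnDensity_add (p₀ := p₀)
    (P := fun p => corrMatrix p.2) (b := fun p => p.1) (fun i j => (hcd i j).contDiffAt)
    (fun i => by fun_prop)
    (eventually_posDef (fun i j => (hcd i j).continuous.continuousAt)
      (fun p => corrMatrix_transpose p.2) hP) (Set.Iic 0)
  refine ⟨_, h3.congr_of_eventuallyEq (Eventually.of_forall fun p =>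
    (mvnCdf_coe _ _ _).trans (setIntegral_Iic_zero_comp_add _ _).symm), fun k => ?_, fun κ => ?_⟩
  · rw [ContinuousLinearMap.integral_apply h2, ← setIntegral_Iic_partial_eq hP
      (corrMatrix_diag ϱ k), ← setIntegral_Iic_zero_comp_add _ b]
    congr 1
    funext u
    -- The derivative under the integral is evaluated as a line derivative; moving `b` moves the
    -- argument `u + b`, so it is a spatial partial derivative of the density.
    have h4 := (h1 u).hasFDerivAt.hasLineDerivAt (Pi.single k 1, 0)
    rw [HasLineDerivAt] at h4
    refine h4.unique ?_
    simp only [hp₀, Prod.fst_add, Prod.snd_add, Prod.smul_fst, Prod.smul_snd, smul_zero, add_zero]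
    have h5 := hasDerivAt_mvnDensity_comp (s := 0)
      (w := fun t : ℝ => u + (b + t • (Pi.single k 1 : Fin d → ℝ)))
      (v := Pi.single k 1) (fun i => by
        simpa using (((hasDerivAt_id' (0 : ℝ)).mul_const _).const_add (b i)).const_add (u i)) hP
    simpa only [zero_smul, add_zero, single_one_dotProduct] using h5
  · rw [ContinuousLinearMap.integral_apply h2, ← setIntegral_Iic_partial₂_eq hP
      (corrMatrix_diag ϱ) κ.2.ne', ← setIntegral_Iic_zero_comp_add _ b]
    congr 1
    funext u
    -- Moving one correlation perturbs two symmetric entries, and Plackett's identity turns this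
    -- into a mixed second derivative.
    have h4 := (h1 u).hasFDerivAt.hasLineDerivAt (0, Pi.single κ 1)
    rw [HasLineDerivAt] at h4
    refine h4.unique ?_
    simp only [hp₀, Prod.fst_add, Prod.snd_add, Prod.smul_fst, Prod.smul_snd, smul_zero, add_zero,
      corrMatrix_add_smul_single]
    exact hasDerivAt_mvnDensity_add_smul_single hP κ.1.1 κ.1.2 (u + b)

/-- If all counts are nonnegative, the latent point stays finite near `l` and the chain rule
applies. If count `j` is negative, its latent coordinate is `⊥` for every mean: the function
vanishes identically, and each formula contains a vanishing mass, bivariate density or conditional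
distribution function. -/
theorem exists_hasFDerivAt_jointCdf {l : Fin d → ℝ} (hl : ∀ j, 0 < l j) {ϱ : StrictLower d → ℝ}
    (hP : (corrMatrix ϱ).PosDef) (x : Fin d → ℤ) :
    ∃ D : (Fin d → ℝ) × (StrictLower d → ℝ) →L[ℝ] ℝ,
      HasFDerivAt (fun p : (Fin d → ℝ) × (StrictLower d → ℝ) =>
        jointCdf p.1 (corrMatrix p.2) x) D (l, ϱ) ∧
      (∀ k, D (Pi.single k 1, 0) = -poissonPmf (l k) (x k) *
        mvnCdf (fun m : Rest1 k => latent l x m)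
          (condMean1 (corrMatrix ϱ) k (latent l x k).toReal) (condCov1 (corrMatrix ϱ) k)) ∧
      ∀ κ, D (0, Pi.single κ 1) =
        phi2 (latent l x κ.1.1) (latent l x κ.1.2) (corrMatrix ϱ κ.1.1 κ.1.2) *
          mvnCdf (fun m : Rest2 κ.1.1 κ.1.2 => latent l x m)
            (condMean2 (corrMatrix ϱ) κ.1.1 κ.1.2
              ![(latent l x κ.1.1).toReal, (latent l x κ.1.2).toReal])
            (condCov2 (corrMatrix ϱ) κ.1.1 κ.1.2) := by
  by_cases hx : ∀ j, 0 ≤ x j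
  · have hlat : ∀ l' : Fin d → ℝ, (∀ j, 0 < l' j) →
        latent l' x = fun j => ((realQuantile (poissonCdf (l' j) (x j)) : ℝ) : EReal) :=
      fun l' hl' => funext fun j => (coe_realQuantile (poissonCdf_mem_Ioo (hl' j) (hx j))).symm
    set β : Fin d → ℝ := fun j => realQuantile (poissonCdf (l j) (x j)) with hβ
    set c : Fin d → ℝ := fun j =>
      (ProbabilityTheory.gaussianPDFReal 0 1 (β j))⁻¹ * -poissonPmf (l j) (x j) with hc
    obtain ⟨D, hD, hD1, hD2⟩ := exists_hasFDerivAt_mvnCdf hP β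
    set Ψ : (Fin d → ℝ) × (StrictLower d → ℝ) →L[ℝ] (Fin d → ℝ) × (StrictLower d → ℝ) :=
      (ContinuousLinearMap.pi fun j => c j • (ContinuousLinearMap.proj j).comp
        (ContinuousLinearMap.fst ℝ (Fin d → ℝ) (StrictLower d → ℝ))).prod
        (ContinuousLinearMap.snd ℝ (Fin d → ℝ) (StrictLower d → ℝ)) with hΨ
    have hΨd : HasFDerivAt (fun p : (Fin d → ℝ) × (StrictLower d → ℝ) =>
        ((fun j => realQuantile (poissonCdf (p.1 j) (x j)) : Fin d → ℝ), p.2)) Ψ (l, ϱ) := by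
      refine HasFDerivAt.prodMk (hasFDerivAt_pi.2 fun j => ?_) hasFDerivAt_snd
      exact HasDerivAt.comp_hasFDerivAt (f := fun p : (Fin d → ℝ) × (StrictLower d → ℝ) => p.1 j)
        (l, ϱ) (hasDerivAt_realQuantile_poissonCdf (hl j) (hx j))
        ((ContinuousLinearMap.proj (R := ℝ) (φ := fun _ : Fin d => ℝ) j).comp
          (ContinuousLinearMap.fst ℝ (Fin d → ℝ) (StrictLower d → ℝ))).hasFDerivAt
    have hlb := hlat l hl
    refine ⟨D.comp Ψ, ?_, fun k => ?_, fun κ => ?_⟩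
    · have hcomp := HasFDerivAt.comp (l, ϱ) (g := fun p : (Fin d → ℝ) × (StrictLower d → ℝ) =>
        mvnCdf (fun j => (p.1 j : EReal)) 0 (corrMatrix p.2)) hD hΨd
      refine hcomp.congr_of_eventuallyEq ?_
      have hev : ∀ᶠ p : (Fin d → ℝ) × (StrictLower d → ℝ) in 𝓝 (l, ϱ), ∀ j, 0 < p.1 j :=
        eventually_all.2 fun j => (by fun_prop : ContinuousAt (fun p : (Fin d → ℝ) ×
          (StrictLower d → ℝ) => p.1 j) (l, ϱ)).eventually_const_lt (hl j)
      filter_upwards [hev] with p hp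
      simp only [jointCdf, hlat p.1 hp, Function.comp_apply]
    · have h1 : Ψ (Pi.single k 1, 0) = c k • (Pi.single k 1, 0) := by
        ext j
        · by_cases hj : j = k
          · subst hj; simp [hΨ]
          · simp [hΨ, hj]
        · simp [hΨ]
      rw [ContinuousLinearMap.comp_apply, h1, map_smul, hD1, smul_eq_mul, hlb]
      simp only [EReal.toReal_coe]
      -- The derivative of the quantile contributes the reciprocal of the marginal density, which
      -- cancels against the density in `hD1`.
      have h2 : ProbabilityTheory.gaussianPDFReal 0 1 (β k) ≠ 0 :=
        (ProbabilityTheory.gaussianPDFReal_pos _ _ _ one_ne_zero).ne'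
      rw [← mul_assoc]
      congr 1
      simp only [hc]
      field_simp
    · have h1 : Ψ (0, Pi.single κ 1) = (0, Pi.single κ 1) := by
        ext j <;> simp [hΨ]
      rw [ContinuousLinearMap.comp_apply, h1, hD2, hlb]
      simp only [EReal.toReal_coe]
      rfl
  · push Not at hx
    obtain ⟨j, hj⟩ := hx
    have hbot : ∀ l' : Fin d → ℝ, latent l' x j = ⊥ := fun l' =>
      stdNormalQuantile_poissonCdf_of_neg _ hj
    refine ⟨0, ?_, fun k => ?_, fun κ => ?_⟩
    · simp only [jointCdf, mvnCdf_eq_zero_of_bot (hbot _)]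
      exact hasFDerivAt_const _ _
    · rw [zero_apply]
      by_cases hk : j = k
      · subst hk
        rw [poissonPmf_of_neg _ hj, neg_zero, zero_mul]
      · rw [mvnCdf_eq_zero_of_bot (j := (⟨j, hk⟩ : Rest1 k)) (hbot l), mul_zero]
    · rw [zero_apply]
      by_cases h1 : j = κ.1.1
      · rw [phi2, if_pos (Or.inl (h1 ▸ hbot l)), zero_mul]
      by_cases h2 : j = κ.1.2
      · rw [phi2, if_pos (Or.inr (Or.inr (Or.inl (h2 ▸ hbot l)))), zero_mul]
      · rw [mvnCdf_eq_zero_of_bot (j := (⟨j, h1, h2⟩ : Rest2 κ.1.1 κ.1.2)) (hbot l), mul_zero]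

/-- Total differentiability of the probability mass function in the Poisson means and in the
correlations, with the scores as partial derivatives. -/
theorem exists_hasFDerivAt_jointPmf {l : Fin d → ℝ} (hl : ∀ j, 0 < l j) {ϱ : StrictLower d → ℝ}
    (hP : (corrMatrix ϱ).PosDef) (y : Fin d → ℕ) :
    ∃ D : (Fin d → ℝ) × (StrictLower d → ℝ) →L[ℝ] ℝ,
      HasFDerivAt (fun p : (Fin d → ℝ) × (StrictLower d → ℝ) =>
        jointPmf p.1 (corrMatrix p.2) y) D (l, ϱ) ∧
      (∀ k, D (Pi.single k 1, 0) = meanScore l (corrMatrix ϱ) y k) ∧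
      ∀ κ, D (0, Pi.single κ 1) = corrScore l (corrMatrix ϱ) y κ := by
  choose D hD hD1 hD2 using fun t : Fin d → Fin 2 => exists_hasFDerivAt_jointCdf hl hP (corner y t)
  refine ⟨∑ t, cornerSign t • D t, ?_, fun k => ?_, fun κ => ?_⟩
  · have hsum : HasFDerivAt (fun p : (Fin d → ℝ) × (StrictLower d → ℝ) =>
        ∑ t : Fin d → Fin 2, cornerSign t * jointCdf p.1 (corrMatrix p.2) (corner y t))
        (∑ t, cornerSign t • D t) (l, ϱ) :=
      HasFDerivAt.fun_sum fun t _ => (hD t).const_mul _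
    refine hsum.congr_of_eventuallyEq ?_
    have hev1 : ∀ᶠ p : (Fin d → ℝ) × (StrictLower d → ℝ) in 𝓝 (l, ϱ), ∀ j, 0 < p.1 j :=
      eventually_all.2 fun j => (by fun_prop : ContinuousAt (fun p : (Fin d → ℝ) ×
          (StrictLower d → ℝ) => p.1 j) (l, ϱ)).eventually_const_lt (hl j)
    have hev2 : ∀ᶠ p : (Fin d → ℝ) × (StrictLower d → ℝ) in 𝓝 (l, ϱ),
        (corrMatrix p.2).PosDef :=
      eventually_posDef (p₀ := (l, ϱ)) (A := fun p : (Fin d → ℝ) × (StrictLower d → ℝ) =>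
        corrMatrix p.2) (fun i j =>
        ((contDiff_corrMatrix_apply i j).continuous.comp continuous_snd).continuousAt)
        (fun p => corrMatrix_transpose p.2) hP
    filter_upwards [hev1, hev2] with p h1 h2 using jointPmf_eq_sum h1 h2 y
  · simp only [sum_apply, smul_apply, smul_eq_mul, hD1,
      meanScore, mul_assoc]
  · simp only [sum_apply, smul_apply, smul_eq_mul, hD2,
      corrScore, mul_assoc]

/-! ### Spherical coordinates for the rows of the triangular factor -/

section Spherical

variable {ω : StrictLower d → ℝ}

theorem angle_eq (ω : StrictLower d → ℝ) (κ : StrictLower d) : angle ω κ.1.1 κ.1.2 = ω κ := by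
  rw [angle, dif_pos κ.2]

theorem sinProd_pos (hω : ∀ κ, 0 < Real.sin (ω κ)) {i : Fin d} {m : ℕ} (hm : m ≤ i.val) :
    0 < sinProd ω i m := by
  refine Finset.prod_pos fun k hk => ?_
  have hki : k < i := Fin.lt_def.2 ((Finset.mem_filter.1 hk).2.trans_le hm)
  rw [angle, dif_pos hki]
  exact hω _

theorem sinProd_zero (ω : StrictLower d → ℝ) (i : Fin d) : sinProd ω i 0 = 1 := by
  simp [sinProd]

theorem sinProd_succ (ω : StrictLower d → ℝ) (i j : Fin d) :
    sinProd ω i (j.val + 1) = sinProd ω i j * Real.sin (angle ω i j) := by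
  have h : (Finset.univ.filter fun k : Fin d => k.val < j.val + 1) =
      insert j (Finset.univ.filter fun k : Fin d => k.val < j.val) := by
    ext k
    simp only [Finset.mem_filter, Finset.mem_univ, true_and, Finset.mem_insert, Fin.ext_iff]
    omega
  rw [sinProd, h, Finset.prod_insert (by simp), mul_comm, sinProd]

/-- Telescoping: $q_m^2=(q_m\cos\omega_m)^2+q_{m+1}^2$, starting from $q=1$ for the empty product.
-/
theorem sum_sq_add_sinProd_sq (ω : StrictLower d → ℝ) (i : Fin d) {m : ℕ} (hm : m ≤ d) :
    ∑ j : Fin d with j.val < m, (sinProd ω i j * Real.cos (angle ω i j)) ^ 2 +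
      sinProd ω i m ^ 2 = 1 := by
  induction m with
  | zero => simp [sinProd_zero]
  | succ m ih =>
    have h : (Finset.univ.filter fun k : Fin d => k.val < m + 1) =
        insert ⟨m, hm⟩ (Finset.univ.filter fun k : Fin d => k.val < m) := by
      ext k
      simp only [Finset.mem_filter, Finset.mem_univ, true_and, Finset.mem_insert, Fin.ext_iff]
      omega
    have h1 := sinProd_succ ω i ⟨m, hm⟩
    simp only at h1
    rw [h, Finset.sum_insert (by simp), h1, ← ih (by omega)]
    simp only
    have h2 := Real.sin_sq_add_cos_sq (angle ω i ⟨m, hm⟩)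
    linear_combination sinProd ω i m ^ 2 * h2

theorem cholesky_mul_transpose_diag (ω : StrictLower d → ℝ) (i : Fin d) :
    (cholesky ω * (cholesky ω).transpose) i i = 1 := by
  -- The index `i` is split off from both sums: its term is the squared diagonal entry in one and
  -- zero in the other.
  rw [Matrix.mul_apply, ← sum_sq_add_sinProd_sq ω i i.2.le, Finset.sum_filter,
    ← Finset.sum_erase_add _ _ (Finset.mem_univ i), ← Finset.sum_erase_add (a := i) (f := fun a : Fin d =>
      if a.val < i.val then (sinProd ω i a * Real.cos (angle ω i a)) ^ 2 else 0) _
      (Finset.mem_univ i), if_neg (lt_irrefl _), add_zero]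
  congr 1
  · refine Finset.sum_congr rfl fun j hj => ?_
    have hne := Finset.ne_of_mem_erase hj
    simp only [cholesky, Matrix.transpose_apply, Matrix.of_apply, Fin.lt_def, if_neg hne]
    split_ifs <;> ring
  · simp [cholesky, sq]

theorem cholesky_det_pos (hω : ∀ κ, 0 < Real.sin (ω κ)) : 0 < (cholesky ω).det := by
  rw [Matrix.det_of_isLowerTriangular]
  · refine Finset.prod_pos fun i _ => ?_
    simpa [cholesky] using sinProd_pos hω le_rfl
  · intro i j hij
    have hij' : i < j := hij
    simp [cholesky, hij'.not_gt, hij'.ne']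

theorem posDef_cholesky_mul_transpose (hω : ∀ κ, 0 < Real.sin (ω κ)) :
    (cholesky ω * (cholesky ω).transpose).PosDef := by
  have h := Matrix.PosDef.mul_conjTranspose_self (cholesky ω)
    (Matrix.vecMul_injective_of_isUnit ((Matrix.isUnit_iff_isUnit_det _).2
      (cholesky_det_pos hω).ne'.isUnit))
  rwa [Matrix.conjTranspose_eq_transpose_of_trivial] at h

theorem angle_update_of_ne (ω : StrictLower d → ℝ) (κ : StrictLower d) (x : ℝ) {i k : Fin d}
    (h : i ≠ κ.1.1 ∨ k ≠ κ.1.2) : angle (Function.update ω κ x) i k = angle ω i k := by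
  unfold angle
  split_ifs with h1
  · rw [Function.update_of_ne]
    rintro rfl
    simp at h
  · rfl

/-- At most one factor depends on the angle; replacing its sine by its cosine multiplies the product
by the cotangent, since the sine is nonzero. -/
theorem hasDerivAt_sinProd (hω : ∀ κ, 0 < Real.sin (ω κ)) (κ : StrictLower d) (n : ℕ) :
    HasDerivAt (fun x => sinProd (Function.update ω κ x) κ.1.1 n)
      (if κ.1.2.val < n then sinProd ω κ.1.1 n * Real.cot (ω κ) else 0) (ω κ) := by
  have hconst : ∀ x, ∀ k, k ≠ κ.1.2 → Real.sin (angle (Function.update ω κ x) κ.1.1 k) =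
      Real.sin (angle ω κ.1.1 k) := fun x k hk => by
    rw [angle_update_of_ne _ _ _ (Or.inr hk)]
  split_ifs with h
  · have hmem : κ.1.2 ∈ Finset.univ.filter fun k : Fin d => k.val < n := by simpa using h
    have h1 : ∀ ω' : StrictLower d → ℝ, sinProd ω' κ.1.1 n = Real.sin (ω' κ) *
        ∏ k ∈ (Finset.univ.filter fun k : Fin d => k.val < n).erase κ.1.2,
          Real.sin (angle ω' κ.1.1 k) := by
      intro ω'
      rw [sinProd, ← Finset.mul_prod_erase _ _ hmem, angle_eq]
    have h2 : ∀ x, sinProd (Function.update ω κ x) κ.1.1 n = Real.sin x *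
        ∏ k ∈ (Finset.univ.filter fun k : Fin d => k.val < n).erase κ.1.2,
          Real.sin (angle ω κ.1.1 k) := by
      intro x
      rw [h1, Function.update_self]
      congr 1
      exact Finset.prod_congr rfl fun k hk => hconst x k (Finset.ne_of_mem_erase hk)
    simp only [h2]
    refine ((Real.hasDerivAt_sin (ω κ)).mul_const _).congr_deriv ?_
    have h3 := (hω κ).ne'
    rw [h1, Real.cot_eq_cos_div_sin]
    field_simp
  · have h2 : ∀ x, sinProd (Function.update ω κ x) κ.1.1 n = sinProd ω κ.1.1 n := by
      intro x
      refine Finset.prod_congr rfl fun k hk => hconst x k ?_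
      rintro rfl
      exact h (Finset.mem_filter.1 hk).2
    simp only [h2]
    exact hasDerivAt_const _ _

/-- For $j<i$ the angle $\omega_{im}$ enters $\alpha_{ij}$ through $q_{ij}$ if $m<j$, through the
cosine if $m=j$, and not at all if $m>j$. In the case $m=j$ the resulting $-q_{ij}\sin\omega_{ij}$
is $-q_{i,j+1}$. -/
theorem hasDerivAt_cholesky (hω : ∀ κ, 0 < Real.sin (ω κ)) (κ : StrictLower d) (j : Fin d) :
    HasDerivAt (fun x => cholesky (Function.update ω κ x) κ.1.1 j) (rowGrad ω κ j) (ω κ) := by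
  have hκ := κ.2
  simp only [cholesky, Matrix.of_apply, rowGrad]
  split_ifs with h1 h2 h3 h3 h4
  · exact absurd h3 h2.ne
  · have h5 : j ≠ κ.1.2 := h2.ne'
    simp only [angle_update_of_ne _ _ _ (Or.inr h5)]
    refine ((hasDerivAt_sinProd hω κ j).mul_const _).congr_deriv ?_
    rw [if_pos (Fin.lt_def.1 h2)]
    ring
  · have h5 : ∀ x, angle (Function.update ω κ x) κ.1.1 j = x := by
      intro x
      rw [← h3, angle_eq, Function.update_self]
    simp only [h5]
    refine ((hasDerivAt_sinProd hω κ j).mul (Real.hasDerivAt_cos _)).congr_deriv ?_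
    rw [if_neg (by rw [h3]; exact lt_irrefl _), sinProd_succ, ← h3, angle_eq,
      Function.update_eq_self]
    ring
  · have h5 : j ≠ κ.1.2 := fun h => h3 h.symm
    simp only [angle_update_of_ne _ _ _ (Or.inr h5)]
    refine ((hasDerivAt_sinProd hω κ j).mul_const _).congr_deriv ?_
    rw [if_neg (fun h => h2 (Fin.lt_def.2 h))]
    ring
  · refine (hasDerivAt_sinProd hω κ _).congr_deriv ?_
    rw [if_pos (Fin.lt_def.1 hκ)]
  · exact hasDerivAt_const _ _

theorem cholesky_update_of_ne (ω : StrictLower d → ℝ) (κ : StrictLower d) (x : ℝ) {i : Fin d}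
    (h : i ≠ κ.1.1) (j : Fin d) : cholesky (Function.update ω κ x) i j = cholesky ω i j := by
  simp only [cholesky, Matrix.of_apply, sinProd, angle_update_of_ne _ _ _ (Or.inl h)]

/-- Only row $i$ of $L$ depends on the angle, so the product rule gives $e_i(Lg)^\top+(Lg)e_i^\top$.
-/
theorem hasDerivAt_cholesky_mul_transpose (hω : ∀ κ, 0 < Real.sin (ω κ)) (κ : StrictLower d)
    (a b : Fin d) :
    HasDerivAt (fun x => (cholesky (Function.update ω κ x) *
        (cholesky (Function.update ω κ x)).transpose) a b)
      ((if a = κ.1.1 then (cholesky ω).mulVec (rowGrad ω κ) b else 0) +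
        (if b = κ.1.1 then (cholesky ω).mulVec (rowGrad ω κ) a else 0)) (ω κ) := by
  have hrow : ∀ a j, HasDerivAt (fun x => cholesky (Function.update ω κ x) a j)
      (if a = κ.1.1 then rowGrad ω κ j else 0) (ω κ) := by
    intro a j
    split_ifs with h
    · rw [h]
      exact hasDerivAt_cholesky hω κ j
    · simp only [cholesky_update_of_ne _ _ _ h]
      exact hasDerivAt_const _ _
  simp only [Matrix.mul_apply, Matrix.transpose_apply]
  refine (HasDerivAt.fun_sum fun j _ => (hrow a j).mul (hrow b j)).congr_deriv ?_
  simp only [Function.update_eq_self, Finset.sum_add_distrib]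
  congr 1
  · split_ifs
    · simp [Matrix.mulVec, dotProduct, mul_comm]
    · simp
  · split_ifs
    · simp [Matrix.mulVec, dotProduct]
    · simp

end Spherical

/-! ### The Kronecker form of the Jacobian -/

section Duplication

theorem isUnit_det_duplication_transpose_mul :
    IsUnit ((duplication d).transpose * duplication d).det := by
  have hinj : Function.Injective (duplication d).mulVec := by
    -- `Matrix.vec` is indexed by (column, row), so the entry in row `κ.1.1` and column `κ.1.2` is
    -- read at the swapped pair.
    refine Function.LeftInverse.injective (g := fun u κ => u (κ.1.2, κ.1.1)) fun v => ?_
    set A : Matrix (Fin d) (Fin d) ℝ := Matrix.of fun a b =>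
      if h : b ≤ a then v ⟨(a, b), h⟩ else v ⟨(b, a), (not_le.1 h).le⟩ with hA
    have hv : vech A = v := by
      funext κ
      simp only [vech, hA, Matrix.of_apply, dif_pos κ.2]
    have hs : A.IsSymm := by
      ext a b
      simp only [hA, Matrix.transpose_apply, Matrix.of_apply]
      rcases lt_trichotomy a b with h | rfl | h
      · simp [h.le, h.not_ge]
      · rfl
      · simp [h.le, h.not_ge]
    rw [← hv, duplication_mulVec_vech A hs]
    rfl
  have h := Matrix.PosDef.conjTranspose_mul_self (duplication d) hinj
  rw [Matrix.conjTranspose_eq_transpose_of_trivial] at h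
  exact h.det_pos.ne'.isUnit

theorem duplicationPinv_mulVec_vec {A : Matrix (Fin d) (Fin d) ℝ} (hA : A.IsSymm) :
    (duplicationPinv d).mulVec A.vec = vech A := by
  rw [← duplication_mulVec_vech A hA, duplicationPinv, Matrix.mulVec_mulVec, Matrix.mul_assoc,
    Matrix.nonsing_inv_mul _ isUnit_det_duplication_transpose_mul, Matrix.one_mulVec]

/-- With $e_i\otimes g=\operatorname{vec}(ge_i^\top)$, the factor $I\otimes L$ produces
$\operatorname{vec}B$ for $B=Lge_i^\top$, $I+K$ symmetrizes it to $B+B^\top$, and $MD^+$ reads off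
the strictly lower entries. -/
theorem vechsJacobian_apply (ζ : StrictLower d → ℝ) (κ τ : StrictLower d) :
    vechsJacobian ζ κ τ =
      (if τ.1.1 = κ.1.1 then (lfac ζ).mulVec (rowGrad (angles ζ) κ) τ.1.2 else 0) +
        (if τ.1.2 = κ.1.1 then (lfac ζ).mulVec (rowGrad (angles ζ) κ) τ.1.1 else 0) := by
  set g := rowGrad (angles ζ) κ with hg
  have h1 : vecKron (Pi.single κ.1.1 1) g =
      (Matrix.vecMulVec g (Pi.single κ.1.1 1)).vec := by
    funext p
    simp [vecKron, Matrix.vec, Matrix.vecMulVec_apply, mul_comm]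
  set B := lfac ζ * Matrix.vecMulVec g (Pi.single κ.1.1 1) with hB
  have hsymm : (B + B.transpose).IsSymm := Matrix.isSymm_add_transpose_self B
  have h2 : vechsJacobian ζ κ = vechs (B + B.transpose) := by
    rw [vechsJacobian, h1, ← Matrix.mulVec_mulVec, ← Matrix.vec_mul_eq_mulVec, ← hB,
      ← Matrix.mulVec_mulVec, Matrix.add_mulVec, Matrix.one_mulVec, commutation_mulVec_vec,
      ← Matrix.mulVec_mulVec]
    have h3 : B.vec + B.transpose.vec = (B + B.transpose).vec := rfl
    rw [h3, duplicationPinv_mulVec_vec hsymm, selection_mulVec_vech]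
  have hBapp : ∀ a b, B a b = if b = κ.1.1 then (lfac ζ).mulVec g a else 0 := by
    intro a b
    rw [hB, Matrix.mul_vecMulVec, Matrix.vecMulVec_apply, Pi.single_apply]
    split_ifs <;> simp
  rw [h2]
  simp only [vechs, Matrix.add_apply, Matrix.transpose_apply, hBapp]
  rw [add_comm]

end Duplication

/-! ### From unconstrained parameters to correlations -/

section Parametrization

theorem sin_angles_pos (ζ : StrictLower d → ℝ) (κ : StrictLower d) :
    0 < Real.sin (angles ζ κ) := by
  refine Real.sin_pos_of_pos_of_lt_pi (mul_pos Real.pi_pos (Real.sigmoid_pos _)) ?_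
  have := mul_lt_mul_of_pos_left (Real.sigmoid_lt_one (ζ κ)) Real.pi_pos
  rwa [mul_one] at this

theorem posDef_scp (ζ : StrictLower d → ℝ) : (scp ζ).PosDef :=
  posDef_cholesky_mul_transpose (sin_angles_pos ζ)

/-- Lets the likelihood factor through the free correlations, where total derivatives are available.
-/
theorem corrMatrix_vechs_scp (ζ : StrictLower d → ℝ) : corrMatrix (vechs (scp ζ)) = scp ζ :=
  corrMatrix_vechs (by simp [scp]) (cholesky_mul_transpose_diag (angles ζ))

theorem angles_add_smul_single (ζ : StrictLower d → ℝ) (κ : StrictLower d) (s : ℝ) :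
    angles (ζ + s • Pi.single κ 1) =
      Function.update (angles ζ) κ (Real.pi * Real.sigmoid (ζ κ + s)) := by
  funext τ
  by_cases h : τ = κ
  · subst h
    simp [angles]
  · simp [angles, h]

theorem hasDerivAt_vechs_scp (ζ : StrictLower d → ℝ) (κ τ : StrictLower d) :
    HasDerivAt (fun s : ℝ => vechs (scp (ζ + s • Pi.single κ 1)) τ)
      (Real.pi * Real.sigmoid (ζ κ) * (1 - Real.sigmoid (ζ κ)) * vechsJacobian ζ κ τ) 0 := by
  simp only [vechs, scp, lfac, angles_add_smul_single]
  have h1 : HasDerivAt (fun s => Real.pi * Real.sigmoid (ζ κ + s))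
      (Real.pi * (Real.sigmoid (ζ κ) * (1 - Real.sigmoid (ζ κ)))) 0 := by
    have h2 : HasDerivAt Real.sigmoid _ (ζ κ + 0) := Real.hasDerivAt_sigmoid _
    have h3 := (HasDerivAt.comp (0 : ℝ) h2 ((hasDerivAt_id' (0 : ℝ)).const_add (ζ κ))).const_mul
      Real.pi
    simpa using h3
  have h4 := hasDerivAt_cholesky_mul_transpose (sin_angles_pos ζ) κ τ.1.1 τ.1.2
  -- The outer derivative must be stated at the value of the inner curve at `0`, which is written
  -- with `ζ κ + 0`.
  have h5 : angles ζ κ = Real.pi * Real.sigmoid (ζ κ + 0) := by rw [add_zero]; rfl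
  rw [h5] at h4
  refine (HasDerivAt.comp (0 : ℝ) h4 h1).congr_deriv ?_
  rw [vechsJacobian_apply]
  simp only [lfac]
  ring

/-- The line derivatives above do not give total differentiability; smoothness of sine, cosine and
the logistic function does. -/
theorem differentiable_vechs_scp (τ : StrictLower d) :
    Differentiable ℝ fun ζ : StrictLower d → ℝ => vechs (scp ζ) τ := by
  have hangle : ∀ i k, ContDiff ℝ 1 fun ζ : StrictLower d → ℝ => angle (angles ζ) i k := by
    intro i k
    unfold angle
    split_ifs
    · simp only [angles]
      exact contDiff_const.mul ((contDiff_sigmoid.of_le le_top).comp (contDiff_apply _ _ _))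
    · exact contDiff_const
  have hsin : ∀ i m, ContDiff ℝ 1 fun ζ : StrictLower d → ℝ => sinProd (angles ζ) i m := by
    intro i m
    unfold sinProd
    exact contDiff_prod fun k _ => (hangle i k).sin
  have hch : ∀ i j, ContDiff ℝ 1 fun ζ : StrictLower d → ℝ => lfac ζ i j := by
    intro i j
    simp only [lfac, cholesky, Matrix.of_apply]
    split_ifs
    · exact (hsin i j).mul (hangle i j).cos
    · exact hsin i i
    · exact contDiff_const
  simp only [vechs, scp, Matrix.mul_apply, Matrix.transpose_apply]
  exact (ContDiff.sum fun j _ => (hch _ j).mul (hch _ j)).differentiable (by simp)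

end Parametrization

/-! ### Partial derivatives of the mass function and the gradient of the log-likelihood -/

theorem means_pos (η : Fin d → ℝ) (k : Fin d) : 0 < means η k := Real.exp_pos _

theorem posDef_corrMatrix_vechs_scp (ζ : StrictLower d → ℝ) :
    (corrMatrix (vechs (scp ζ))).PosDef := by
  rw [corrMatrix_vechs_scp]
  exact posDef_scp ζ

theorem hasDerivAt_jointPmf_mean (η : Fin d → ℝ) (ζ : StrictLower d → ℝ) (y : Fin d → ℕ)
    (k : Fin d) :
    HasDerivAt (fun x => jointPmf (Function.update (means η) k x) (scp ζ) y)
      (meanScore (means η) (scp ζ) y k) (means η k) := by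
  obtain ⟨D, hD, hD1, -⟩ := exists_hasFDerivAt_jointPmf (means_pos η)
    (posDef_corrMatrix_vechs_scp ζ) y
  have h1 : HasDerivAt (fun x => (Function.update (means η) k x, vechs (scp ζ)))
      ((Pi.single k 1 : Fin d → ℝ), (0 : StrictLower d → ℝ)) (means η k) :=
    (hasDerivAt_update _ _ _).prodMk (hasDerivAt_const _ _)
  have h2 : HasFDerivAt (fun p : (Fin d → ℝ) × (StrictLower d → ℝ) =>
      jointPmf p.1 (corrMatrix p.2) y) D
      ((fun x => (Function.update (means η) k x, vechs (scp ζ))) (means η k)) := by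
    simpa using hD
  have h3 := h2.comp_hasDerivAt _ h1
  rw [hD1, corrMatrix_vechs_scp] at h3
  simpa only [Function.comp_def, corrMatrix_vechs_scp] using h3

theorem hasDerivAt_jointPmf_corr (η : Fin d → ℝ) (ζ : StrictLower d → ℝ) (y : Fin d → ℕ)
    (κ : StrictLower d) :
    HasDerivAt (fun x => jointPmf (means η)
        (corrMatrix (Function.update (vechs (scp ζ)) κ x)) y)
      (corrScore (means η) (scp ζ) y κ) (vechs (scp ζ) κ) := by
  obtain ⟨D, hD, -, hD2⟩ := exists_hasFDerivAt_jointPmf (means_pos η)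
    (posDef_corrMatrix_vechs_scp ζ) y
  have h1 : HasDerivAt (fun x => (means η, Function.update (vechs (scp ζ)) κ x))
      ((0 : Fin d → ℝ), (Pi.single κ 1 : StrictLower d → ℝ)) (vechs (scp ζ) κ) :=
    (hasDerivAt_const _ _).prodMk (hasDerivAt_update _ _ _)
  have h2 : HasFDerivAt (fun p : (Fin d → ℝ) × (StrictLower d → ℝ) =>
      jointPmf p.1 (corrMatrix p.2) y) D
      ((fun x => (means η, Function.update (vechs (scp ζ)) κ x)) (vechs (scp ζ) κ)) := by
    simpa using hD
  have h3 := h2.comp_hasDerivAt _ h1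
  rwa [hD2, corrMatrix_vechs_scp] at h3

/-- The Poisson means and the correlations as a function of the unconstrained parameters. -/
noncomputable def modelParams (ψ : EuclideanSpace ℝ (Fin d ⊕ StrictLower d)) :
    (Fin d → ℝ) × (StrictLower d → ℝ) :=
  (means fun k => ψ (Sum.inl k), vechs (scp fun κ => ψ (Sum.inr κ)))

theorem differentiable_modelParams : Differentiable ℝ (modelParams (d := d)) := by
  refine Differentiable.prodMk (differentiable_pi.2 fun k => ?_) (differentiable_pi.2 fun τ => ?_)
  · unfold means
    fun_prop
  · exact (differentiable_vechs_scp τ).comp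
      (f := fun ψ : EuclideanSpace ℝ (Fin d ⊕ StrictLower d) => fun κ => ψ (Sum.inr κ))
      (by fun_prop)

theorem fderiv_modelParams_inl (η : Fin d → ℝ) (ζ : StrictLower d → ℝ) (k : Fin d) :
    fderiv ℝ modelParams (WithLp.toLp 2 (Sum.elim η ζ)) (EuclideanSpace.single (Sum.inl k) 1) =
      Real.exp (η k) • (Pi.single k 1, 0) := by
  have h1 := (differentiable_modelParams
    (WithLp.toLp 2 (Sum.elim η ζ))).hasFDerivAt.hasLineDerivAt (EuclideanSpace.single (Sum.inl k) 1)
  rw [HasLineDerivAt] at h1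
  refine h1.unique ?_
  rw [Prod.smul_mk, smul_zero]
  refine HasDerivAt.prodMk (hasDerivAt_pi.2 fun j => ?_) ?_
  · simp only [means, PiLp.add_apply, PiLp.smul_apply, Sum.elim_inl, PiLp.single_apply,
      Sum.inl.injEq, smul_eq_mul, Pi.smul_apply, Pi.single_apply]
    have h2 := (((hasDerivAt_id' (0 : ℝ)).mul_const (if j = k then (1 : ℝ) else 0)).const_add
      (η j)).exp
    refine h2.congr_deriv ?_
    by_cases hj : j = k
    · subst hj; simp
    · simp [hj]
  · simpa using hasDerivAt_const (0 : ℝ) (vechs (scp ζ))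

theorem fderiv_modelParams_inr (η : Fin d → ℝ) (ζ : StrictLower d → ℝ) (κ : StrictLower d) :
    fderiv ℝ modelParams (WithLp.toLp 2 (Sum.elim η ζ)) (EuclideanSpace.single (Sum.inr κ) 1) =
      (0, (Real.pi * Real.sigmoid (ζ κ) * (1 - Real.sigmoid (ζ κ))) • vechsJacobian ζ κ) := by
  have h1 := (differentiable_modelParams
    (WithLp.toLp 2 (Sum.elim η ζ))).hasFDerivAt.hasLineDerivAt (EuclideanSpace.single (Sum.inr κ) 1)
  rw [HasLineDerivAt] at h1
  refine h1.unique ?_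
  have h2 : ∀ t : ℝ, (fun τ : StrictLower d => (WithLp.toLp 2 (Sum.elim η ζ) +
      t • EuclideanSpace.single (Sum.inr κ) (1 : ℝ) :
        EuclideanSpace ℝ (Fin d ⊕ StrictLower d)) (Sum.inr τ)) =
      ζ + t • Pi.single κ 1 := by
    intro t
    funext τ
    simp [PiLp.single_apply, Pi.single_apply]
  refine HasDerivAt.prodMk ?_ (hasDerivAt_pi.2 fun τ => ?_)
  · simpa using hasDerivAt_const (0 : ℝ) (means η)
  · simp only [h2]
    exact hasDerivAt_vechs_scp ζ κ τ

theorem hasGradientAt_logLik {n : ℕ} (y : Fin n → Fin d → ℕ) (η : Fin d → ℝ)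
    (ζ : StrictLower d → ℝ) :
    HasGradientAt (logLik y)
      (WithLp.toLp 2 (Sum.elim
        (fun k => ∑ r, 1 / jointPmf (means η) (scp ζ) (y r) *
          (meanScore (means η) (scp ζ) (y r) k * Real.exp (η k)))
        (fun κ => ∑ r, 1 / jointPmf (means η) (scp ζ) (y r) *
          (Real.pi * Real.sigmoid (ζ κ) * (1 - Real.sigmoid (ζ κ)) *
            (corrScore (means η) (scp ζ) (y r) ⬝ᵥ vechsJacobian ζ κ)))))
      (WithLp.toLp 2 (Sum.elim η ζ)) := by
  set ψ : EuclideanSpace ℝ (Fin d ⊕ StrictLower d) := WithLp.toLp 2 (Sum.elim η ζ) with hψ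
  choose D hD hD1 hD2 using fun r => exists_hasFDerivAt_jointPmf (means_pos η)
    (posDef_corrMatrix_vechs_scp ζ) (y r)
  have hparams : modelParams ψ = (means η, vechs (scp ζ)) := rfl
  have hΘ := (differentiable_modelParams ψ).hasFDerivAt
  have hlog : HasFDerivAt (logLik y) (∑ r, (jointPmf (means η) (scp ζ) (y r))⁻¹ •
      (D r).comp (fderiv ℝ modelParams ψ)) ψ := by
    have hfun : logLik y = fun φ => ∑ r,
        Real.log (jointPmf (modelParams φ).1 (corrMatrix (modelParams φ).2) (y r)) := by
      funext φ
      simp only [logLik, modelParams, corrMatrix_vechs_scp]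
    rw [hfun]
    refine HasFDerivAt.fun_sum fun r _ => ?_
    have h1 : HasFDerivAt (fun φ => jointPmf (modelParams φ).1 (corrMatrix (modelParams φ).2)
        (y r)) ((D r).comp (fderiv ℝ modelParams ψ)) ψ := by
      have h2 : HasFDerivAt (fun p : (Fin d → ℝ) × (StrictLower d → ℝ) =>
          jointPmf p.1 (corrMatrix p.2) (y r)) (D r) (modelParams ψ) := by
        rw [hparams]
        exact hD r
      exact h2.comp ψ hΘ
    have h3 : jointPmf (modelParams ψ).1 (corrMatrix (modelParams ψ).2) (y r) =
        jointPmf (means η) (scp ζ) (y r) := by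
      rw [hparams, corrMatrix_vechs_scp]
    have h4 := h1.log (by
      rw [h3]
      exact (jointPmf_pos (means_pos η) (posDef_scp ζ) (y r)).ne')
    rwa [h3] at h4
  -- By linearity the derivative along a general correlation direction is the score paired with it;
  -- the direction needed is a column of the Jacobian.
  have hlin : ∀ r (v : StrictLower d → ℝ),
      D r (0, v) = corrScore (means η) (scp ζ) (y r) ⬝ᵥ v := by
    intro r v
    have h1 : ((0 : Fin d → ℝ), v) =
        ∑ τ, v τ • ((0 : Fin d → ℝ), (Pi.single τ 1 : StrictLower d → ℝ)) := by
      refine Prod.ext ?_ ?_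
      · simp [Prod.fst_sum]
      · rw [Prod.snd_sum]
        simp only [Prod.smul_mk]
        exact pi_eq_sum_univ' v
    rw [h1, map_sum]
    simp only [map_smul, hD2, corrMatrix_vechs_scp, smul_eq_mul, dotProduct]
    exact Finset.sum_congr rfl fun τ _ => mul_comm _ _
  rw [hasGradientAt_iff_hasFDerivAt]
  -- Two linear functionals agree if they agree on the standard basis, where the gradient pairing
  -- returns its components.
  refine hlog.congr_fderiv (ContinuousLinearMap.coe_injective
    ((EuclideanSpace.basisFun (Fin d ⊕ StrictLower d) ℝ).toBasis.ext fun i => ?_))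
  rw [OrthonormalBasis.coe_toBasis, EuclideanSpace.basisFun_apply]
  simp only [ContinuousLinearMap.coe_coe, InnerProductSpace.toDual_apply_apply,
    EuclideanSpace.inner_single_right, sum_apply, smul_apply, ContinuousLinearMap.comp_apply,
    conj_trivial, one_mul, smul_eq_mul]
  rcases i with k | κ
  · simp only [hψ, fderiv_modelParams_inl, map_smul, hD1, corrMatrix_vechs_scp, smul_eq_mul,
      Sum.elim_inl]
    exact Finset.sum_congr rfl fun r _ => by ring
  · simp only [hψ, fderiv_modelParams_inr, hlin, dotProduct_smul, smul_eq_mul, Sum.elim_inr]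
    exact Finset.sum_congr rfl fun r _ => by ring

end GaussianPoisson

theorem mainTheorem2 (d n : ℕ) (y : Fin n → Fin d → ℕ)
    (η : Fin d → ℝ) (ζ : StrictLower d → ℝ) :
    -- the likelihood terms are positive and given by inclusion-exclusion
    (∀ r, 0 < jointPmf (means η) (scp ζ) (y r) ∧
      jointPmf (means η) (scp ζ) (y r) =
        ∑ t : Fin d → Fin 2, cornerSign t * jointCdf (means η) (scp ζ) (corner (y r) t)) ∧
    -- the scores are the partial derivatives in the original parameters
    (∀ r k, HasDerivAt
      (fun x => jointPmf (Function.update (means η) k x) (scp ζ) (y r))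
      (meanScore (means η) (scp ζ) (y r) k) (means η k)) ∧
    (∀ r κ, HasDerivAt
      (fun x => jointPmf (means η)
        (corrMatrix (Function.update (vechs (scp ζ)) κ x)) (y r))
      (corrScore (means η) (scp ζ) (y r) κ) (vechs (scp ζ) κ)) ∧
    -- `g_{im}` is the derivative of the `i`-th row of `L` in the angle `ω_{im}`
    (∀ (κ : StrictLower d) (j : Fin d), HasDerivAt
      (fun x => cholesky (Function.update (angles ζ) κ x) κ.1.1 j)
      (rowGrad (angles ζ) κ j) (angles ζ κ)) ∧
    -- the gradient in the unconstrained parameters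
    HasGradientAt (logLik y)
      (WithLp.toLp 2 (Sum.elim
        (fun k => ∑ r, 1 / jointPmf (means η) (scp ζ) (y r) *
          (meanScore (means η) (scp ζ) (y r) k * Real.exp (η k)))
        (fun κ => ∑ r, 1 / jointPmf (means η) (scp ζ) (y r) *
          (Real.pi * Real.sigmoid (ζ κ) * (1 - Real.sigmoid (ζ κ)) *
            (corrScore (means η) (scp ζ) (y r) ⬝ᵥ vechsJacobian ζ κ)))))
      (WithLp.toLp 2 (Sum.elim η ζ)) := by
  refine ⟨fun r => ⟨jointPmf_pos (means_pos η) (posDef_scp ζ) (y r),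
    jointPmf_eq_sum (means_pos η) (posDef_scp ζ) (y r)⟩,
    fun r k => hasDerivAt_jointPmf_mean η ζ (y r) k,
    fun r κ => hasDerivAt_jointPmf_corr η ζ (y r) κ,
    fun κ j => hasDerivAt_cholesky (sin_angles_pos ζ) κ j, hasGradientAt_logLik y η ζ⟩
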